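/- **A lower bound theorem for $\mathcal W_k(d)$.** All simplicial complexes are finite and abstract. *Definitions.* For a finite set $\alpha$, $\overline\alpha$ (resp. $\partial\alpha$) is the complex of all (resp. all proper) subsets of $\alpha$, and $X*Y$ denotes the join. The standard sphere $S^{e}_{e+2}$ is $\partial\alpha$ with $\#\alpha=e+2$. If $X$ is an $e$-dimensional complex and $\alpha,\beta$ are disjoint non-empty finite sets with $\dim\alpha+\dim\beta=e$ such that the subcomplex of $X$ induced on $\alpha\sqcup\beta$ is $\overline\alpha*\partial\beta$, then $Y=(X\setminus(\overline\alpha*\partial\beta))\cup(\partial\alpha*\overline\beta)$ is said to be obtained from $X$ by a bistellar move of index $\dim\beta$. (A move of index $0$ introduces a new vertex.) An $e$-dimensional complex is a $k$-stellated sphere if, up to isomorphism, it is obtained from $S^{e}_{e+2}$ by a finite sequence of bistellar moves, each of index $<k$. For $0\le k\le d$, $\mathcal W_k(d)$ is the class of connected $d$-dimensional simplicial complexes all of whose vertex links are $k$-stellated $(d-1)$-spheres. A complex is 2-neighbourly if any two of its vertices form an edge. For a complex $M$ of dimension $d$ with $f_i$ faces of dimension $i$ ($f_{-1}=1$), put $$h_j=\sum_{i=-1}^{j-1}(-1)^{j-i-1}\binom{d-i}{j-i-1}f_i\quad(0\le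 j\le d+1),\qquad h_{-1}=0,\qquad g_j=h_j-h_{j-1}\quad(0\le j\le d+1).$$ For a field $\mathbb F$, $\beta_i=\dim_{\mathbb F}H_i(M;\mathbb F)$ denotes the (unreduced) $i$-th Betti number of $M$. *Statement.* Let $0\le k\le d$, let $M\in\mathcal W_k(d)$ be 2-neighbourly, and let $\mathbb F$ be any field. Then: (a) if $d=2k$, then $g_{l+1}\ge\binom{d+2}{l+1}\sum_{i=1}^{l}(-1)^{l-i}\beta_i$ for $1\le l\le k-1$; (b) if $d\ge 2k+1$, then $g_{l+1}\ge\binom{d+2}{l+1}\sum_{i=1}^{l}(-1)^{l-i}\beta_i$ for $1\le l\le k$; (c) if $d\ge 2k+2$, then $g_{l+1}=\binom{d+2}{l+1}\sum_{i=1}^{l}(-1)^{l-i}\beta_i$ for $k\le l\le d-k-1$; (d) if $d\ge 2k+2$, then $\beta_i=0$ for $k+1\le i\le d-k-1$. -/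

import Mathlib

namespace PreAbstractSimplicialComplex

/- Conventions.  Faces of a complex are nonempty finite sets, as in Mathlib; the empty face, which
combinatorialists count as a face of every complex, is put back by hand where it matters (in joins
and in the `f`-vector).  The vertices of a complex `X` are the `v` with `{v} ∈ X`; the ambient type
may contain further points.  A face with `i + 1` vertices has dimension `i`. -/

section Combinatorics

variable {V : Type*}

/-- The simplicial complex of all (nonempty) subsets of the finite set `α`. -/
def simplex (α : Finset V) : PreAbstractSimplicialComplex V where
  faces := {σ | σ.Nonempty ∧ σ ⊆ α}
  isRelLowerSet_faces := fun {_} h => ⟨h.1, fun _ hts ht => ⟨ht, hts.trans h.2⟩⟩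

/-- The boundary complex of the simplex on `α`: all (nonempty) proper subsets of `α`.  If `α` has
`n + 1` elements this is the standard sphere of dimension `n - 1`. -/
def simplexBoundary (α : Finset V) : PreAbstractSimplicialComplex V where
  faces := {σ | σ.Nonempty ∧ σ ⊂ α}
  isRelLowerSet_faces := fun {_} h => ⟨h.1, fun _ hts ht => ⟨ht, lt_of_le_of_lt hts h.2⟩⟩

/-- The subcomplex of `X` induced on the vertices in `A`. -/
def induced (X : PreAbstractSimplicialComplex V) (A : Set V) : PreAbstractSimplicialComplex V where
  faces := {σ | σ ∈ X ∧ (σ : Set V) ⊆ A}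
  isRelLowerSet_faces := fun {_} h => ⟨(X.isRelLowerSet_faces h.1).1, fun _ hts ht =>
    ⟨(X.isRelLowerSet_faces h.1).2 hts ht, (Finset.coe_subset.2 hts).trans h.2⟩⟩

/-- The join of two complexes: its faces are the disjoint unions of a face of `X` and a face
of `Y`, where each of the two may be the empty face (but not both). -/
def join [DecidableEq V] (X Y : PreAbstractSimplicialComplex V) :
    PreAbstractSimplicialComplex V where
  faces := {σ | σ.Nonempty ∧ ∃ a b : Finset V, (a = ∅ ∨ a ∈ X) ∧ (b = ∅ ∨ b ∈ Y) ∧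
    Disjoint a b ∧ σ = a ∪ b}
  isRelLowerSet_faces := by
    rintro σ ⟨hσ, a, b, ha, hb, hab, rfl⟩
    refine ⟨hσ, fun τ hτ hne => ⟨hne, a ∩ τ, b ∩ τ, ?_, ?_, ?_, ?_⟩⟩
    · rcases Finset.eq_empty_or_nonempty (a ∩ τ) with h | h
      · exact Or.inl h
      · rcases ha with rfl | ha
        · simp at h
        · exact Or.inr ((X.isRelLowerSet_faces ha).2 Finset.inter_subset_left h)
    · rcases Finset.eq_empty_or_nonempty (b ∩ τ) with h | h
      · exact Or.inl h
      · rcases hb with rfl | hb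
        · simp at h
        · exact Or.inr ((Y.isRelLowerSet_faces hb).2 Finset.inter_subset_left h)
    · exact Finset.disjoint_of_subset_left Finset.inter_subset_left
        (Finset.disjoint_of_subset_right Finset.inter_subset_left hab)
    · rw [← Finset.union_inter_distrib_right]
      exact (Finset.inter_eq_right.2 hτ).symm

/-- The link of the vertex `v`. -/
def link [DecidableEq V] (X : PreAbstractSimplicialComplex V) (v : V) :
    PreAbstractSimplicialComplex V where
  faces := {σ | σ.Nonempty ∧ v ∉ σ ∧ insert v σ ∈ X}
  isRelLowerSet_faces := fun {_} h => ⟨h.1, fun _ hts ht => ⟨ht, fun hv => h.2.1 (hts hv),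
    (X.isRelLowerSet_faces h.2.2).2 (Finset.insert_subset_insert _ hts)
      (Finset.insert_nonempty _ _)⟩⟩

/-- `X` has dimension `d`. -/
def HasDim (X : PreAbstractSimplicialComplex V) (d : ℕ) : Prop :=
  (∃ σ ∈ X, σ.card = d + 1) ∧ ∀ σ ∈ X, σ.card ≤ d + 1

/-- Any two vertices of `X` are joined by a path of edges of `X`. -/
def Connected [DecidableEq V] (X : PreAbstractSimplicialComplex V) : Prop :=
  (∃ v : V, {v} ∈ X) ∧ ∀ u v : V, {u} ∈ X → {v} ∈ X →
    Relation.ReflTransGen (fun a b : V => ({a, b} : Finset V) ∈ X) u v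

/-- `X` is `l`-neighbourly: any `l` vertices of `X` form a face. -/
def Neighbourly (X : PreAbstractSimplicialComplex V) (l : ℕ) : Prop :=
  ∀ σ : Finset V, σ.Nonempty → (∀ v ∈ σ, {v} ∈ X) → σ.card = l → σ ∈ X

/-- `Y` is obtained from the `(n - 1)`-dimensional complex `X` by a bistellar move `α ↦ β` of index
`dim β = β.card - 1` less than `k`: the induced subcomplex of `X` on `α ⊔ β` is the
`(n - 1)`-dimensional complex `simplex α * ∂β`, and it is replaced by `∂α * simplex β`. -/
def BistellarMove [DecidableEq V] (n k : ℕ) (X Y : PreAbstractSimplicialComplex V) : Prop :=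
  ∃ α β : Finset V, α.Nonempty ∧ β.Nonempty ∧ Disjoint α β ∧
    α.card + β.card = n + 1 ∧ β.card - 1 < k ∧
    X.induced ((α ∪ β : Finset V) : Set V) = join (simplex α) (simplexBoundary β) ∧
    Y.faces = (X.faces \ (join (simplex α) (simplexBoundary β)).faces) ∪
      (join (simplexBoundary α) (simplex β)).faces

/-- `X` is a `k`-stellated sphere of dimension `n - 1`: up to isomorphism, it is obtained from the
standard sphere of dimension `n - 1`, which has `n + 1` vertices, by finitely many bistellar moves
of index less than `k`.  The moves take place on a countably infinite supply of vertices, as they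
may create new ones; the dimension is written `n - 1` so that dimension `-1` is included. -/
def IsStellatedSphere (n k : ℕ) (X : PreAbstractSimplicialComplex V) : Prop :=
  ∃ f : V → ℕ, Set.InjOn f {v | {v} ∈ X} ∧
    Relation.ReflTransGen (BistellarMove n k) (simplexBoundary (Finset.range (n + 1))) (X.map f)

/-- The class `W_k(d)`, `0 ≤ k ≤ d`: the finite connected simplicial complexes of dimension `d` all
of whose vertex links are `k`-stellated spheres of dimension `d - 1`. -/
structure IsW [DecidableEq V] (k d : ℕ) (X : PreAbstractSimplicialComplex V) : Prop where
  le : k ≤ d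
  finite : X.faces.Finite
  hasDim : X.HasDim d
  connected : X.Connected
  link : ∀ v : V, {v} ∈ X → IsStellatedSphere d k (X.link v)

/-- The number `f_{s-1}` of faces with `s` elements; `f_{-1} = 1` counts the empty face. -/
noncomputable def faceCount (X : PreAbstractSimplicialComplex V) (s : ℕ) : ℕ :=
  if s = 0 then 1 else {σ : Finset V | σ ∈ X ∧ σ.card = s}.ncard

/-- The `h`-numbers of a complex `X` of dimension `d`, for `0 ≤ j ≤ d + 1`:
`h_j = ∑_{i=-1}^{j-1} (-1)^{j-i-1} C(d-i, j-i-1) f_i`, with `s = i + 1`. -/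
noncomputable def hNumber (X : PreAbstractSimplicialComplex V) (d j : ℕ) : ℤ :=
  ∑ s ∈ Finset.range (j + 1), (-1) ^ (j - s) * ((d + 1 - s).choose (j - s) : ℤ) * X.faceCount s

/-- The `g`-numbers of a complex `X` of dimension `d`, for `0 ≤ j ≤ d + 1`:
`g_j = h_j - h_{j-1}`, with `h_{-1} = 0`. -/
noncomputable def gNumber (X : PreAbstractSimplicialComplex V) (d : ℕ) : ℕ → ℤ
  | 0 => X.hNumber d 0
  | j + 1 => X.hNumber d (j + 1) - X.hNumber d j

end Combinatorics

section Homology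

/-- The dimension of the quotient space `Z / B`, for subspaces `B ≤ Z` of a vector space. -/
noncomputable def quotientDim {F C : Type*} [Field F] [AddCommGroup C] [Module F C]
    (Z B : Submodule F C) : ℕ :=
  Module.finrank F (Z ⧸ B.submoduleOf Z)

variable {V : Type*} [LinearOrder V] (F : Type*) [Field F]

/-- The simplicial boundary operator with coefficients in `F`: each simplex is oriented by the order
of `V`, and its facet opposite to `v` gets the sign `(-1)^{number of vertices before v}`. -/
noncomputable def boundaryMap (V : Type*) [LinearOrder V] (F : Type*) [Field F] :
    (Finset V →₀ F) →ₗ[F] (Finset V →₀ F) :=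
  Finsupp.linearCombination F fun σ : Finset V =>
    ∑ v ∈ σ, Finsupp.single (σ.erase v) ((-1 : F) ^ (σ.filter (· < v)).card)

/-- The space of `i`-dimensional simplicial chains of `X`. -/
noncomputable def chains (X : PreAbstractSimplicialComplex V) (i : ℕ) :
    Submodule F (Finset V →₀ F) :=
  Finsupp.supported F F {σ : Finset V | σ ∈ X ∧ σ.card = i + 1}

/-- The `i`-dimensional simplicial cycles; all `0`-chains are cycles (unreduced homology). -/
noncomputable def cycles (X : PreAbstractSimplicialComplex V) : ℕ → Submodule F (Finset V →₀ F)
  | 0 => X.chains F 0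
  | i + 1 => X.chains F (i + 1) ⊓ LinearMap.ker (boundaryMap V F)

/-- The `i`-dimensional simplicial boundaries. -/
noncomputable def boundaries (X : PreAbstractSimplicialComplex V) (i : ℕ) :
    Submodule F (Finset V →₀ F) :=
  (X.chains F (i + 1)).map (boundaryMap V F)

/-- The Betti number `β_i(X; F) = dim H_i(X; F)`, where `H_i(X; F)` is the space of cycles modulo
the space of boundaries. -/
noncomputable def betti (X : PreAbstractSimplicialComplex V) (i : ℕ) : ℕ :=
  quotientDim (X.cycles F i) (X.boundaries F i)

end Homology

end PreAbstractSimplicialComplex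

/-
Order the vertices of `M` at random and add them one at a time. Adding `v` adds the faces `σ ∪ {v}`
for `σ` in the part of the link of `v` spanned by the earlier vertices. A bistellar move `α ↦ β` of
index less than `k` creates few small faces: if `#σ ≤ d - k`, then `σ` is new precisely when
`β ⊆ σ ⊆ α ∪ β`. Hence the faces of the link with at most `d - k` elements are a disjoint union of
intervals `[A, B]` with `#A ≤ k` and `#B = d + 1`. If `E` is the set of earlier vertices, then the
members of `[A, B]` inside `E` are matched perfectly by a vertex of `B ∩ E` outside `A`, if there is
one; otherwise at most one of them exists, namely `A` in case `B ∩ E = A`, and it is critical. This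
gives an acyclic matching on `M`, and therefore Morse inequalities for its Betti numbers.

An interval with `#A = j` contributes a critical face with probability `1 / ((d + 2) C(d + 1, j))`,
and the intervals of all links are counted by the `g`-numbers of `M`. With
`G_j = g_j / C(d + 2, j)`, the expected number of critical faces of dimension `j` is
`G_{j+1} + G_j`, so that the alternating sums telescope and the averaged Morse inequalities say that
the gap `a_l = G_{l+1} - ∑_{i=1}^l (-1)^{l-i} β_i` is nonnegative. There are no intervals with
`#A > k`, which gives `G_{j+1} + G_j = 0` for `k < j ≤ d - k`. Consequently
`a_l + a_{l+1} = -β_{l+1}` for `k ≤ l ≤ d - k - 2`, and all three terms vanish.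
-/

namespace LocallyStellated

open Finset PreAbstractSimplicialComplex

section AlternatingSums

variable {R : Type*} [CommRing R]

/-- The truncated alternating sum `a l - a (l - 1) + ⋯ + (-1) ^ l * a 0`, as a linear functional of
the sequence `a`. -/
def altSum : ℕ → (ℕ → R) →ₗ[R] R
  | 0 => LinearMap.proj 0
  | l + 1 => LinearMap.proj (l + 1) - altSum l

theorem altSum_zero (a : ℕ → R) : altSum 0 a = a 0 := rfl

theorem altSum_succ (l : ℕ) (a : ℕ → R) : altSum (l + 1) a = a (l + 1) - altSum l a := rfl

theorem altSum_add (l : ℕ) (a b : ℕ → R) :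
    altSum l (fun u => a u + b u) = altSum l a + altSum l b := map_add (altSum l) a b

theorem altSum_congr {l : ℕ} {a b : ℕ → R} (h : ∀ u ≤ l, a u = b u) :
    altSum l a = altSum l b := by
  induction l with
  | zero => exact h 0 le_rfl
  | succ l ih => rw [altSum_succ, altSum_succ, h _ le_rfl, ih fun u hu => h u (by omega)]

theorem altSum_eq_of_consecutive {a b : ℕ → R} {e : R} {l : ℕ} (h0 : a 0 = b 0 + e)
    (h : ∀ u < l, a (u + 1) = b (u + 1) + b u) : altSum l a = b l + (-1) ^ l * e := by
  induction l with
  | zero => rw [altSum_zero, h0, pow_zero, one_mul]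
  | succ l ih =>
    rw [altSum_succ, h l l.lt_succ_self, ih fun u hu => h u (by omega), pow_succ]
    ring

theorem altSum_eq_sum_Icc (l : ℕ) (a : ℕ → R) :
    altSum l a = ∑ i ∈ Icc 1 l, (-1) ^ (l - i) * a i + (-1) ^ l * a 0 := by
  induction l with
  | zero => simp [altSum_zero]
  | succ l ih =>
    have hsign : ∑ i ∈ Icc 1 l, (-1) ^ (l + 1 - i) * a i =
        -∑ i ∈ Icc 1 l, (-1) ^ (l - i) * a i := by
      rw [← sum_neg_distrib]
      refine sum_congr rfl fun i hi => ?_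
      rw [Nat.succ_sub (mem_Icc.1 hi).2, pow_succ]
      ring
    rw [altSum_succ, ih, sum_Icc_succ_top (by omega), hsign, Nat.sub_self, pow_succ]
    ring

end AlternatingSums

section Matchings

variable {V : Type*}

/-- A matching of faces with `s` elements to faces with `s + 1` elements, given as the list of its
pairs. It is acyclic in the sense of discrete Morse theory: the list is ordered so that the small
face of a pair lies in none of the large faces that come later. -/
structure IsAcyclicMatching (s : ℕ) (C : List (Finset V × Finset V)) : Prop where
  subset : ∀ p ∈ C, p.1 ⊆ p.2
  card_fst : ∀ p ∈ C, #p.1 = s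
  card_snd : ∀ p ∈ C, #p.2 = s + 1
  pairwise : C.Pairwise fun p q => ¬ p.1 ⊆ q.2

namespace IsAcyclicMatching

theorem nil (s : ℕ) : IsAcyclicMatching (V := V) s [] := by constructor <;> simp

theorem append {s : ℕ} {C C' : List (Finset V × Finset V)} (hC : IsAcyclicMatching s C)
    (hC' : IsAcyclicMatching s C') (h : ∀ p ∈ C, ∀ q ∈ C', ¬ p.1 ⊆ q.2) :
    IsAcyclicMatching s (C ++ C') where
  subset p hp := (List.mem_append.1 hp).elim (hC.subset p) (hC'.subset p)
  card_fst p hp := (List.mem_append.1 hp).elim (hC.card_fst p) (hC'.card_fst p)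
  card_snd p hp := (List.mem_append.1 hp).elim (hC.card_snd p) (hC'.card_snd p)
  pairwise := List.pairwise_append.2 ⟨hC.pairwise, hC'.pairwise, h⟩

theorem map_insert [DecidableEq V] {s : ℕ} {C : List (Finset V × Finset V)}
    (hC : IsAcyclicMatching s C) {a : V} (ha : ∀ p ∈ C, a ∉ p.2) :
    IsAcyclicMatching (s + 1) (C.map fun p => (insert a p.1, insert a p.2)) where
  subset := List.forall_mem_map.2 fun p hp => insert_subset_insert a (hC.subset p hp)
  card_fst := List.forall_mem_map.2 fun p hp => by
    rw [card_insert_of_notMem fun h => ha p hp (hC.subset p hp h), hC.card_fst p hp]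
  card_snd := List.forall_mem_map.2 fun p hp => by
    rw [card_insert_of_notMem (ha p hp), hC.card_snd p hp]
  pairwise := List.pairwise_map.2 <| hC.pairwise.imp_of_mem fun {p q} hp _ hpq h =>
    hpq <| (insert_subset_insert_iff fun h => ha p hp (hC.subset p hp h)).1 h

theorem of_insert [DecidableEq V] {s : ℕ} {S : Finset (Finset V)} {a : V}
    (hS : ∀ σ ∈ S, #σ = s ∧ a ∉ σ) :
    IsAcyclicMatching s (S.toList.map fun σ => (σ, insert a σ)) where
  subset := List.forall_mem_map.2 fun σ _ => subset_insert a σ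
  card_fst := List.forall_mem_map.2 fun σ hσ => (hS σ (mem_toList.1 hσ)).1
  card_snd := List.forall_mem_map.2 fun σ hσ => by
    rw [card_insert_of_notMem (hS σ (mem_toList.1 hσ)).2, (hS σ (mem_toList.1 hσ)).1]
  pairwise := List.pairwise_map.2 <| S.nodup_toList.imp_of_mem fun {σ τ} hσ hτ hne h =>
    hne <| eq_of_subset_of_card_le
      ((subset_insert_iff_of_notMem (hS σ (mem_toList.1 hσ)).2).1 h)
      (((hS σ (mem_toList.1 hσ)).1.trans (hS τ (mem_toList.1 hτ)).1.symm).ge)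

end IsAcyclicMatching

/-- The number of members of the family `F` that consist of `u` elements of `A`. -/
noncomputable def levelCount (F : Set (Finset V)) (A : Finset V) (u : ℕ) : ℕ :=
  open Classical in #{σ ∈ A.powersetCard u | σ ∈ F}

theorem levelCount_congr {F G : Set (Finset V)} {A : Finset V} {u : ℕ}
    (h : ∀ σ ⊆ A, #σ = u → (σ ∈ F ↔ σ ∈ G)) : levelCount F A u = levelCount G A u := by
  classical
  refine congr_arg card (filter_congr fun σ hσ => ?_)
  exact h σ (mem_powersetCard.1 hσ).1 (mem_powersetCard.1 hσ).2

theorem levelCount_eq_zero {F : Set (Finset V)} {A : Finset V} {u : ℕ}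
    (h : ∀ σ ⊆ A, #σ = u → σ ∉ F) : levelCount F A u = 0 := by
  classical
  refine card_eq_zero.2 (eq_empty_of_forall_notMem fun σ hσ => ?_)
  obtain ⟨hσA, hσF⟩ := mem_filter.1 hσ
  exact h σ (mem_powersetCard.1 hσA).1 (mem_powersetCard.1 hσA).2 hσF

theorem levelCount_union {F G : Set (Finset V)} {A : Finset V} {u : ℕ}
    (h : ∀ σ ∈ F, #σ = u → σ ∉ G) :
    levelCount (F ∪ G) A u = levelCount F A u + levelCount G A u := by
  classical
  refine Eq.trans (congr_arg card ?_) (card_union_of_disjoint ?_)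
  · ext σ
    simp only [mem_filter, mem_union, Set.mem_union, and_or_left]
  · exact disjoint_filter.2 fun σ hσ hF => h σ hF (mem_powersetCard.1 hσ).2

theorem levelCount_cons {I : NonemptyInterval (Finset V)} {L : List (NonemptyInterval (Finset V))}
    {c u : ℕ} (h : ∀ J ∈ L, ∀ σ ∈ J, #σ ≤ c → ¬ I.fst ⊆ σ) (A : Finset V) (hu : u ≤ c) :
    levelCount {σ | ∃ J ∈ I :: L, σ ∈ J} A u =
      levelCount {σ | σ ∈ I} A u + levelCount {σ | ∃ J ∈ L, σ ∈ J} A u := by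
  rw [← levelCount_union]
  · simp only [List.exists_mem_cons_iff, Set.ofPred_or]
  · rintro σ hσI rfl ⟨J, hJ, hσJ⟩
    exact h J hJ σ hσJ hu hσI.1

variable [DecidableEq V]

theorem levelCount_insert (F : Set (Finset V)) {A : Finset V} {a : V} (ha : a ∉ A) (u : ℕ) :
    levelCount F (insert a A) (u + 1) =
      levelCount F A (u + 1) + levelCount {σ | insert a σ ∈ F} A u := by
  classical
  have notMem : ∀ {n σ}, σ ∈ powersetCard n A → a ∉ σ := fun hσ h =>
    ha ((mem_powersetCard.1 hσ).1 h)
  rw [levelCount, powersetCard_succ_insert ha, filter_union, card_union_of_disjoint, filter_image,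
    card_image_of_injOn]
  · rfl
  · exact insert_erase_invOn.2.injOn.mono fun σ hσ => notMem (mem_filter.1 hσ).1
  · refine disjoint_left.2 fun σ hσ hσ' => ?_
    obtain ⟨τ, -, rfl⟩ := mem_image.1 (mem_filter.1 hσ').1
    exact notMem (mem_filter.1 hσ).1 (mem_insert_self a τ)

end Matchings

section Intervals

variable {V : Type*} [DecidableEq V]

/-- The number of intervals `I` in `L` whose minimum `I.fst` has `u` elements and is the only subset
of `A` in `I`. These minima are the critical faces of the matching constructed below. -/
def criticalCount (L : List (NonemptyInterval (Finset V))) (A : Finset V) (u : ℕ) : ℕ :=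
  L.countP fun I => I.snd ∩ A = I.fst ∧ #I.fst = u

theorem criticalCount_singleton (I : NonemptyInterval (Finset V)) (A : Finset V) (u : ℕ) :
    criticalCount [I] A u = if I.snd ∩ A = I.fst ∧ #I.fst = u then 1 else 0 := by
  simp only [criticalCount, List.countP_singleton, decide_eq_true_eq]

theorem criticalCount_cons (I : NonemptyInterval (Finset V))
    (L : List (NonemptyInterval (Finset V))) (A : Finset V) (u : ℕ) :
    criticalCount (I :: L) A u = criticalCount [I] A u + criticalCount L A u :=
  List.countP_append (l₁ := [I])

theorem levelCount_interval_of_inter_subset {I : NonemptyInterval (Finset V)} {A : Finset V}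
    (h : I.snd ∩ A ⊆ I.fst) (u : ℕ) : levelCount {σ | σ ∈ I} A u = criticalCount [I] A u := by
  classical
  have hmem : ∀ σ ⊆ A, (σ ∈ I ↔ I.snd ∩ A = I.fst ∧ σ = I.fst) := fun σ hσ => by
    refine ⟨fun hσI => ?_, fun ⟨_, hσI⟩ => hσI ▸ NonemptyInterval.mem_def.2 ⟨le_rfl, I.fst_le_snd⟩⟩
    have hsub : σ ⊆ I.snd ∩ A := subset_inter hσI.2 hσ
    exact ⟨h.antisymm (subset_trans hσI.1 hsub), (hsub.trans h).antisymm hσI.1⟩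
  rw [criticalCount_singleton]
  split_ifs with hI
  · refine card_eq_one.2 ⟨I.fst, eq_singleton_iff_unique_mem.2 ⟨?_, fun σ hσ => ?_⟩⟩
    · have hA : I.fst ⊆ A := hI.1 ▸ inter_subset_right
      exact mem_filter.2 ⟨mem_powersetCard.2 ⟨hA, hI.2⟩, (hmem _ hA).2 ⟨hI.1, rfl⟩⟩
    · rw [mem_filter, mem_powersetCard] at hσ
      exact ((hmem σ hσ.1.1).1 hσ.2).2
  · refine levelCount_eq_zero fun σ hσA hσu hσI => hI ?_
    obtain ⟨hIA, rfl⟩ := (hmem σ hσA).1 hσI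
    exact ⟨hIA, hσu⟩

theorem altSum_levelCount_of_insert_mem_iff {F : Set (Finset V)} {A : Finset V} {a : V}
    (ha : a ∈ A) (hF : ∀ σ, a ∉ σ → (insert a σ ∈ F ↔ σ ∈ F)) (l : ℕ) :
    altSum l (fun u => (levelCount F A u : ℚ)) = levelCount F (A.erase a) l := by
  have hsucc : ∀ u < l, (levelCount F A (u + 1) : ℚ) =
      levelCount F (A.erase a) (u + 1) + levelCount F (A.erase a) u := fun u _ => by
    have hinsert := levelCount_insert F (notMem_erase a A) u
    rw [insert_erase ha, levelCount_congr (F := {σ | insert a σ ∈ F}) (G := F) fun σ hσ _ =>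
      hF σ (notMem_mono hσ (notMem_erase a A))] at hinsert
    exact_mod_cast hinsert
  have hzero : (levelCount F A 0 : ℚ) = levelCount F (A.erase a) 0 + 0 := by
    rw [levelCount, levelCount, powersetCard_zero, powersetCard_zero, add_zero]
  rw [altSum_eq_of_consecutive (b := fun u => (levelCount F (A.erase a) u : ℚ)) hzero hsucc,
    mul_zero, add_zero]

theorem exists_isAcyclicMatching_interval (I : NonemptyInterval (Finset V)) (A : Finset V) (l : ℕ) :
    ∃ C, IsAcyclicMatching l C ∧ (∀ p ∈ C, p.1 ∈ I ∧ p.2 ∈ I ∧ p.2 ⊆ A) ∧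
      altSum l (fun u => (levelCount {σ | σ ∈ I} A u : ℚ)) =
        C.length + altSum l (fun u => (criticalCount [I] A u : ℚ)) := by
  classical
  by_cases hA : I.snd ∩ A ⊆ I.fst
  · refine ⟨[], .nil l, by simp only [List.not_mem_nil, false_imp_iff, implies_true], ?_⟩
    simp only [levelCount_interval_of_inter_subset hA, List.length_nil, Nat.cast_zero, zero_add]
  obtain ⟨a, ha, haI⟩ := not_subset.1 hA
  obtain ⟨haI', haA⟩ := mem_inter.1 ha
  have mem_insert : ∀ σ, a ∉ σ → (insert a σ ∈ I ↔ σ ∈ I) := fun σ _ => by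
    simp only [NonemptyInterval.mem_def, insert_subset_iff, haI', true_and,
      subset_insert_iff_of_notMem haI]
  have mem_S : ∀ σ, σ ∈ {σ ∈ (A.erase a).powersetCard l | σ ∈ I} →
      (#σ = l ∧ a ∉ σ) ∧ σ ∈ I ∧ insert a σ ⊆ A := fun σ hσ => by
    rw [mem_filter, mem_powersetCard] at hσ
    have haσ : a ∉ σ := fun h => notMem_erase a A (hσ.1.1 h)
    exact ⟨⟨hσ.1.2, haσ⟩, hσ.2, insert_subset haA (hσ.1.1.trans (erase_subset a A))⟩
  have hcrit : ∀ u, criticalCount [I] A u = 0 := fun u => by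
    rw [criticalCount_singleton, if_neg]
    exact fun h => haI (h.1 ▸ ha)
  refine ⟨_, .of_insert fun σ hσ => (mem_S σ hσ).1, List.forall_mem_map.2 fun σ hσ => ?_, ?_⟩
  · obtain ⟨⟨-, haσ⟩, hσI, hσA⟩ := mem_S σ (mem_toList.1 hσ)
    exact ⟨hσI, (mem_insert σ haσ).2 hσI, hσA⟩
  have hzero : altSum l (fun u => (criticalCount [I] A u : ℚ)) = 0 := by
    simp only [hcrit, Nat.cast_zero]
    exact map_zero _
  rw [altSum_levelCount_of_insert_mem_iff (F := {σ | σ ∈ I}) haA mem_insert, hzero,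
    List.length_map, length_toList, add_zero]
  rfl

theorem exists_isAcyclicMatching_of_pairwise {L : List (NonemptyInterval (Finset V))} {c l : ℕ}
    (hL : L.Pairwise fun I J => ∀ σ ∈ J, #σ ≤ c → ¬ I.fst ⊆ σ) (hl : l + 1 ≤ c) (A : Finset V) :
    ∃ C, IsAcyclicMatching l C ∧ (∀ p ∈ C, p.2 ⊆ A ∧ ∃ I ∈ L, p.2 ∈ I) ∧
      altSum l (fun u => (levelCount {σ | ∃ I ∈ L, σ ∈ I} A u : ℚ)) =
        C.length + altSum l (fun u => (criticalCount L A u : ℚ)) := by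
  induction L with
  | nil =>
    refine ⟨[], .nil l, by simp, ?_⟩
    simp [levelCount, criticalCount]
  | cons I L ih =>
    obtain ⟨hI, hL⟩ := List.pairwise_cons.1 hL
    obtain ⟨C, hC, hCA, hCcount⟩ := ih hL
    obtain ⟨C', hC', hCA', hCcount'⟩ := exists_isAcyclicMatching_interval I A l
    refine ⟨C' ++ C, hC'.append hC fun p hp q hq hpq => ?_, fun p hp => ?_, ?_⟩
    · obtain ⟨-, J, hJ, hqJ⟩ := hCA q hq
      exact hI J hJ q.2 hqJ ((hC.card_snd q hq).trans_le hl)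
        (subset_trans (hCA' p hp).1.1 hpq)
    · rcases List.mem_append.1 hp with hp | hp
      · exact ⟨(hCA' p hp).2.2, I, List.mem_cons_self, (hCA' p hp).2.1⟩
      · obtain ⟨hpA, J, hJ, hpJ⟩ := hCA p hp
        exact ⟨hpA, J, List.mem_cons_of_mem I hJ, hpJ⟩
    · have hlevel : ∀ u ≤ l, (levelCount {σ | ∃ J ∈ I :: L, σ ∈ J} A u : ℚ) =
          levelCount {σ | σ ∈ I} A u + levelCount {σ | ∃ J ∈ L, σ ∈ J} A u := fun u hu => by
        exact_mod_cast levelCount_cons hI A (by omega)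
      simp only [criticalCount_cons I L, List.length_append, Nat.cast_add, altSum_add,
        altSum_congr hlevel, hCcount, hCcount']
      ring

end Intervals

section Shellings

variable {V : Type*}

theorem mem_of_subset_of_mem {X : PreAbstractSimplicialComplex V} {σ τ : Finset V} (hσ : σ ∈ X)
    (hτσ : τ ⊆ σ) (hτ : τ.Nonempty) : τ ∈ X := (X.isRelLowerSet_faces hσ).2 hτσ hτ

theorem singleton_mem_of_mem {X : PreAbstractSimplicialComplex V} {σ : Finset V} {v : V}
    (hσ : σ ∈ X) (hv : v ∈ σ) : {v} ∈ X :=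
  mem_of_subset_of_mem hσ (singleton_subset_iff.2 hv) (singleton_nonempty v)

/-- The faces of `X` together with the empty face. -/
def augmentedFaces (X : PreAbstractSimplicialComplex V) : Set (Finset V) :=
  insert ∅ X.faces

theorem isLowerSet_augmentedFaces (X : PreAbstractSimplicialComplex V) :
    IsLowerSet (augmentedFaces X) := by
  rintro σ τ hτσ (rfl | hσ)
  · exact Or.inl (subset_empty.1 hτσ)
  · exact τ.eq_empty_or_nonempty.imp_right (mem_of_subset_of_mem hσ hτσ)

theorem singleton_mem_of_mem_augmentedFaces {X : PreAbstractSimplicialComplex V} {σ : Finset V}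
    {v : V} (hσ : σ ∈ augmentedFaces X) (hv : v ∈ σ) : {v} ∈ X :=
  hσ.elim (fun h => absurd (h ▸ hv) (notMem_empty v)) (singleton_mem_of_mem · hv)

theorem mem_augmentedFaces_simplex {α σ : Finset V} :
    σ ∈ augmentedFaces (simplex α) ↔ σ ⊆ α := by
  refine ⟨?_, fun h => σ.eq_empty_or_nonempty.imp_right fun hσ => ⟨hσ, h⟩⟩
  rintro (rfl | h)
  exacts [empty_subset α, h.2]

theorem mem_augmentedFaces_simplexBoundary {α σ : Finset V} (hα : α.Nonempty) :
    σ ∈ augmentedFaces (simplexBoundary α) ↔ σ ⊂ α := by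
  refine ⟨?_, fun h => σ.eq_empty_or_nonempty.imp_right fun hσ => ⟨hσ, h⟩⟩
  rintro (rfl | h)
  exacts [empty_ssubset.2 hα, h.2]

theorem augmentedFaces_induced {X : PreAbstractSimplicialComplex V} {A σ : Finset V}
    (hσ : σ ⊆ A) : σ ∈ augmentedFaces (X.induced A) ↔ σ ∈ augmentedFaces X :=
  or_congr_right (and_iff_left (coe_subset.2 hσ))

/-- The augmented faces of `X` with at most `c` elements are those of a union of intervals in `L`.
Every interval has a maximum with `d + 1` elements and a minimum with at most `k` elements, and
in the order opposite to that of `L` each interval is disjoint from the subcomplex generated by its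
predecessors. -/
structure IsSkeletonShelling (X : PreAbstractSimplicialComplex V) (d k c : ℕ)
    (L : List (NonemptyInterval (Finset V))) : Prop where
  card_snd : ∀ I ∈ L, #I.snd = d + 1
  card_fst_le : ∀ I ∈ L, #I.fst ≤ k
  singleton_mem : ∀ I ∈ L, ∀ x ∈ I.snd, {x} ∈ X
  pairwise : L.Pairwise fun I J => ∀ σ ∈ J, #σ ≤ c → ¬ I.fst ⊆ σ
  mem_iff : ∀ σ, #σ ≤ c → (σ ∈ augmentedFaces X ↔ ∃ I ∈ L, σ ∈ I)

theorem isSkeletonShelling_simplexBoundary {d k c : ℕ} {α : Finset V} (hα : #α = d + 1)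
    (hd : 1 ≤ d) (hc : c ≤ d) :
    IsSkeletonShelling (simplexBoundary α) d k c [⟨(∅, α), empty_subset α⟩] where
  card_snd := List.forall_mem_singleton.2 hα
  card_fst_le := List.forall_mem_singleton.2 (Nat.zero_le k)
  singleton_mem := List.forall_mem_singleton.2 fun x hx =>
    ⟨singleton_nonempty x, (singleton_subset_iff.2 hx).ssubset_of_ne fun h : {x} = α => by
      rw [← h, card_singleton] at hα
      omega⟩
  pairwise := List.pairwise_singleton _ _
  mem_iff σ hσ := by
    have hασ : ¬ α ⊆ σ := fun h => by
      have := card_le_card h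
      omega
    rw [mem_augmentedFaces_simplexBoundary (card_pos.1 (by omega))]
    simp only [List.mem_singleton, exists_eq_left, ssubset_iff_subset_not_subset, hασ,
      NonemptyInterval.mem_def, empty_subset, not_false_eq_true, and_true, true_and]

variable [DecidableEq V]

theorem mem_augmentedFaces_join {X Y : PreAbstractSimplicialComplex V} {σ : Finset V} :
    σ ∈ augmentedFaces (join X Y) ↔
      ∃ a ∈ augmentedFaces X, ∃ b ∈ augmentedFaces Y, Disjoint a b ∧ σ = a ∪ b := by
  constructor
  · rintro (rfl | ⟨-, a, b, ha, hb, hab, rfl⟩)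
    · exact ⟨∅, Or.inl rfl, ∅, Or.inl rfl, disjoint_empty_left ∅, (union_empty ∅).symm⟩
    · exact ⟨a, ha, b, hb, hab, rfl⟩
  · rintro ⟨a, ha, b, hb, hab, rfl⟩
    exact (a ∪ b).eq_empty_or_nonempty.imp_right fun h => ⟨h, a, b, ha, hb, hab, rfl⟩

theorem mem_augmentedFaces_join_comm {X Y : PreAbstractSimplicialComplex V} {σ : Finset V} :
    σ ∈ augmentedFaces (join X Y) ↔ σ ∈ augmentedFaces (join Y X) := by
  have swap : ∀ {X Y : PreAbstractSimplicialComplex V},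
      σ ∈ augmentedFaces (join X Y) → σ ∈ augmentedFaces (join Y X) := fun h => by
    obtain ⟨a, ha, b, hb, hab, rfl⟩ := mem_augmentedFaces_join.1 h
    exact mem_augmentedFaces_join.2 ⟨b, hb, a, ha, hab.symm, union_comm a b⟩
  exact ⟨swap, swap⟩

theorem mem_augmentedFaces_join_simplex_simplexBoundary {α β σ : Finset V} (hαβ : Disjoint α β)
    (hβ : β.Nonempty) : σ ∈ augmentedFaces (join (simplex α) (simplexBoundary β)) ↔
      σ ⊆ α ∪ β ∧ ¬ β ⊆ σ := by
  simp only [mem_augmentedFaces_join, mem_augmentedFaces_simplex,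
    mem_augmentedFaces_simplexBoundary hβ]
  constructor
  · rintro ⟨a, ha, b, hb, -, rfl⟩
    exact ⟨union_subset_union ha hb.1, fun h =>
      hb.2 ((disjoint_of_subset_left ha hαβ).symm.left_le_of_le_sup_left h)⟩
  · rintro ⟨hσ, hβσ⟩
    refine ⟨σ ∩ α, inter_subset_right, σ ∩ β,
      ⟨inter_subset_right, fun h => hβσ (h.trans inter_subset_left)⟩,
      disjoint_of_subset_left inter_subset_right (disjoint_of_subset_right inter_subset_right hαβ),
      by rw [← inter_union_distrib_left, inter_eq_left.2 hσ]⟩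

theorem exists_interval_of_bistellarMove {X Y : PreAbstractSimplicialComplex V} {d k c : ℕ}
    (h : BistellarMove d k X Y) (hck : c + k ≤ d) :
    ∃ I : NonemptyInterval (Finset V), #I.snd = d + 1 ∧ #I.fst ≤ k ∧
      (∀ σ ⊆ I.snd, (σ ∈ augmentedFaces X ↔ ¬ I.fst ⊆ σ)) ∧
      ∀ σ, #σ ≤ c → (σ ∈ augmentedFaces Y ↔ σ ⊆ I.snd ∨ σ ∈ augmentedFaces X) := by
  obtain ⟨α, β, hα, hβ, hαβ, hcard, hβk, hind, hY⟩ := h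
  have hX : ∀ σ ⊆ α ∪ β, (σ ∈ augmentedFaces X ↔ ¬ β ⊆ σ) := fun σ hσ => by
    rw [← augmentedFaces_induced hσ, hind,
      mem_augmentedFaces_join_simplex_simplexBoundary hαβ hβ, and_iff_right hσ]
  have hβk' : #β ≤ k := by omega
  refine ⟨⟨(β, α ∪ β), subset_union_right⟩, by rw [card_union_of_disjoint hαβ, hcard], hβk', hX,
    fun σ hσ => ?_⟩
  have hασ : ¬ α ⊆ σ := fun h => by
    have := card_le_card h
    omega
  have hnew : σ ∈ augmentedFaces (join (simplexBoundary α) (simplex β)) ↔ σ ⊆ α ∪ β := by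
    rw [mem_augmentedFaces_join_comm,
      mem_augmentedFaces_join_simplex_simplexBoundary hαβ.symm hα, and_iff_left hασ, union_comm]
  have hYmem : σ ∈ augmentedFaces Y ↔ σ ∈ augmentedFaces X \
      augmentedFaces (join (simplex α) (simplexBoundary β)) ∨
      σ ∈ augmentedFaces (join (simplexBoundary α) (simplex β)) := by
    simp only [augmentedFaces, hY, Set.mem_insert_iff, Set.mem_union, Set.mem_sdiff]
    tauto
  rw [hYmem, Set.mem_sdiff, mem_augmentedFaces_join_simplex_simplexBoundary hαβ hβ, hnew]
  by_cases hσαβ : σ ⊆ α ∪ β <;> simp [hσαβ]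

namespace IsSkeletonShelling

theorem bistellarMove {X Y : PreAbstractSimplicialComplex V} {d k c : ℕ}
    {L : List (NonemptyInterval (Finset V))} (hL : IsSkeletonShelling X d k c L) (hc : 1 ≤ c)
    (hck : c + k ≤ d) (h : BistellarMove d k X Y) : ∃ L', IsSkeletonShelling Y d k c L' := by
  obtain ⟨I, hsnd, hfst, hIX, hY⟩ := exists_interval_of_bistellarMove h hck
  have singleton_mem : ∀ x, x ∈ I.snd ∨ {x} ∈ X → {x} ∈ Y := fun x hx => by
    refine singleton_mem_of_mem_augmentedFaces ((hY {x} ?_).2 ?_) (mem_singleton_self x)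
    · rwa [card_singleton]
    · exact hx.imp singleton_subset_iff.2 Or.inr
  refine ⟨I :: L, ⟨List.forall_mem_cons.2 ⟨hsnd, hL.card_snd⟩,
    List.forall_mem_cons.2 ⟨hfst, hL.card_fst_le⟩, List.forall_mem_cons.2 ⟨fun x hx =>
      singleton_mem x (Or.inl hx), fun J hJ x hx => singleton_mem x (Or.inr
        (hL.singleton_mem J hJ x hx))⟩, List.pairwise_cons.2 ⟨fun J hJ σ hσJ hσ hIσ => ?_,
          hL.pairwise⟩, fun σ hσ => ?_⟩⟩
  · exact (hIX I.fst I.fst_le_snd).1 (isLowerSet_augmentedFaces X hIσ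
      ((hL.mem_iff σ hσ).2 ⟨J, hJ, hσJ⟩)) subset_rfl
  · rw [hY σ hσ, List.exists_mem_cons_iff, ← hL.mem_iff σ hσ, NonemptyInterval.mem_def]
    have := hIX σ
    tauto

end IsSkeletonShelling

variable {W : Type*}

theorem mem_augmentedFaces_map {X : PreAbstractSimplicialComplex W} {f : W → V} {σ : Finset V} :
    σ ∈ augmentedFaces (X.map f) ↔ ∃ τ ∈ augmentedFaces X, τ.image f = σ := by
  constructor
  · rintro (rfl | ⟨τ, hτ, rfl⟩)
    exacts [⟨∅, Or.inl rfl, image_empty f⟩, ⟨τ, Or.inr hτ, rfl⟩]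
  · rintro ⟨τ, rfl | hτ, rfl⟩
    exacts [Or.inl (image_empty f), Or.inr ⟨τ, hτ, rfl⟩]

theorem mem_map_image {I : NonemptyInterval (Finset W)} {g : W → V}
    (hg : Set.InjOn g I.snd) {σ : Finset V} :
    σ ∈ I.map ⟨image g, fun _ _ => image_subset_image⟩ ↔ ∃ τ ∈ I, τ.image g = σ := by
  constructor
  · rintro ⟨hfst, hsnd⟩
    obtain ⟨τ, hτ, rfl⟩ := subset_image_iff.1 hsnd
    exact ⟨τ, ⟨(image_subset_image_iff_of_injOn hg I.fst_le_snd hτ).1 hfst, hτ⟩, rfl⟩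
  · rintro ⟨τ, hτ, rfl⟩
    exact ⟨image_subset_image hτ.1, image_subset_image hτ.2⟩

theorem IsSkeletonShelling.map {Y : PreAbstractSimplicialComplex W} {d k c : ℕ}
    {L : List (NonemptyInterval (Finset W))} (hL : IsSkeletonShelling Y d k c L) {g : W → V}
    (hg : Set.InjOn g {w | {w} ∈ Y}) :
    IsSkeletonShelling (Y.map g) d k c
      (L.map (NonemptyInterval.map ⟨image g, fun _ _ => image_subset_image⟩)) := by
  have hsnd : ∀ I ∈ L, (I.snd : Set W) ⊆ {w | {w} ∈ Y} := hL.singleton_mem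
  have hcard : ∀ {τ : Finset W}, (τ : Set W) ⊆ {w | {w} ∈ Y} → #(τ.image g) = #τ := fun hτ =>
    card_image_of_injOn (hg.mono hτ)
  refine ⟨List.forall_mem_map.2 fun I hI => (hcard (hsnd I hI)).trans (hL.card_snd I hI),
    List.forall_mem_map.2 fun I hI => card_image_le.trans (hL.card_fst_le I hI),
    List.forall_mem_map.2 fun I hI x hx => ?_,
    List.pairwise_map.2 <| hL.pairwise.imp_of_mem fun {I J} hI hJ hIJ σ hσ hσc hIσ => ?_,
    fun σ hσc => ?_⟩
  · obtain ⟨w, hw, rfl⟩ := mem_image.1 hx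
    exact ⟨{w}, hL.singleton_mem I hI w hw, image_singleton g w⟩
  · obtain ⟨τ, hτ, rfl⟩ := (mem_map_image (hg.mono (hsnd J hJ))).1 hσ
    have hτsnd : (τ : Set W) ⊆ {w | {w} ∈ Y} := (coe_subset.2 hτ.2).trans (hsnd J hJ)
    have hfst : (I.fst : Set W) ⊆ {w | {w} ∈ Y} := (coe_subset.2 I.fst_le_snd).trans (hsnd I hI)
    have himage : g '' I.fst ⊆ g '' τ := by exact_mod_cast hIσ
    exact hIJ τ hτ (hcard hτsnd ▸ hσc)
      (coe_subset.1 ((hg.image_subset_image_iff hfst hτsnd).1 himage))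
  · simp only [mem_augmentedFaces_map, List.mem_map, exists_exists_and_eq_and]
    constructor
    · rintro ⟨τ, hτ, rfl⟩
      rw [hcard fun w hw => singleton_mem_of_mem_augmentedFaces hτ hw] at hσc
      obtain ⟨I, hI, hτI⟩ := (hL.mem_iff τ hσc).1 hτ
      exact ⟨I, hI, (mem_map_image (hg.mono (hsnd I hI))).2 ⟨τ, hτI, rfl⟩⟩
    · rintro ⟨I, hI, hσI⟩
      obtain ⟨τ, hτI, rfl⟩ := (mem_map_image (hg.mono (hsnd I hI))).1 hσI
      rw [hcard ((coe_subset.2 hτI.2).trans (hsnd I hI))] at hσc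
      exact ⟨τ, (hL.mem_iff τ hσc).2 ⟨I, hI, hτI⟩, rfl⟩

theorem map_map_eq_self [DecidableEq W] {X : PreAbstractSimplicialComplex V} {f : V → W}
    {g : W → V} (hgf : Set.LeftInvOn g f {v | {v} ∈ X}) : (X.map f).map g = X := by
  have himage : ∀ σ ∈ X, (σ.image f).image g = σ := fun σ hσ => by
    rw [image_image]
    exact (image_congr fun v hv => hgf (singleton_mem_of_mem hσ hv)).trans image_id
  ext σ
  constructor
  · rintro ⟨_, ⟨σ, hσ, rfl⟩, rfl⟩
    exact Set.mem_of_eq_of_mem (himage σ hσ) hσ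
  · exact fun hσ => ⟨_, ⟨σ, hσ, rfl⟩, himage σ hσ⟩

end Shellings

theorem exists_isSkeletonShelling {V : Type*} [Nonempty V] {X : PreAbstractSimplicialComplex V}
    {d k c : ℕ} (hX : IsStellatedSphere d k X) (hc : 1 ≤ c) (hck : c + k ≤ d) :
    ∃ L, IsSkeletonShelling X d k c L := by
  classical
  obtain ⟨f, hf, hmoves⟩ := hX
  have shelling : ∀ Y, Relation.ReflTransGen (BistellarMove d k)
      (simplexBoundary (range (d + 1))) Y → ∃ L, IsSkeletonShelling Y d k c L := fun Y hY => by
    induction hY with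
    | refl => exact ⟨_, isSkeletonShelling_simplexBoundary (card_range _) (by omega) (by omega)⟩
    | tail _ hmove ih =>
      obtain ⟨L, hL⟩ := ih
      exact hL.bistellarMove hc hck hmove
  obtain ⟨L, hL⟩ := shelling _ hmoves
  have hvertices : {w | {w} ∈ X.map f} ⊆ f '' {v | {v} ∈ X} := by
    rintro w ⟨σ, hσ, hσw⟩
    obtain ⟨v, hv, rfl⟩ := mem_image.1 (hσw ▸ mem_singleton_self w)
    exact ⟨v, singleton_mem_of_mem hσ hv, rfl⟩
  have hL' := hL.map ((Function.invFunOn_injOn_image f {v | {v} ∈ X}).mono hvertices)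
  rw [map_map_eq_self hf.leftInvOn_invFunOn] at hL'
  exact ⟨_, hL'⟩

section VertexByVertex

variable {V : Type*} [DecidableEq V]

theorem mem_augmentedFaces_link {X : PreAbstractSimplicialComplex V} {v : V} (hv : {v} ∈ X)
    {σ : Finset V} (hσ : v ∉ σ) : σ ∈ augmentedFaces (X.link v) ↔ insert v σ ∈ X := by
  refine ⟨?_, fun h => σ.eq_empty_or_nonempty.imp_right fun hne => ⟨hne, hσ, h⟩⟩
  rintro (rfl | h)
  exacts [hv, h.2.2]

theorem levelCount_faces_insert {X : PreAbstractSimplicialComplex V} {v : V} (hv : {v} ∈ X)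
    {W : Finset V} (hvW : v ∉ W) (u : ℕ) : levelCount X.faces (insert v W) (u + 1) =
      levelCount X.faces W (u + 1) + levelCount (augmentedFaces (X.link v)) W u := by
  rw [levelCount_insert X.faces hvW, levelCount_congr (F := {σ | insert v σ ∈ X.faces})
    (G := augmentedFaces (X.link v)) fun σ hσ _ =>
      (mem_augmentedFaces_link hv (notMem_mono hσ hvW)).symm]

theorem exists_isAcyclicMatching_of_links {α : Type*} [LinearOrder α]
    {X : PreAbstractSimplicialComplex V} {d k c l : ℕ} {L : V → List (NonemptyInterval (Finset V))}
    (hL : ∀ v, {v} ∈ X → IsSkeletonShelling (X.link v) d k c (L v)) (hl : l + 1 ≤ c)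
    {key : V → α} (hkey : Function.Injective key) (W : Finset V) (hW : ∀ v ∈ W, {v} ∈ X) :
    ∃ C, IsAcyclicMatching (l + 1) C ∧ (∀ p ∈ C, p.2 ⊆ W ∧ p.2 ∈ X) ∧
      altSum l (fun u => (levelCount X.faces W (u + 1) : ℚ)) = C.length +
        ∑ v ∈ W, altSum l (fun u => (criticalCount (L v) {x ∈ W | key x < key v} u : ℚ)) := by
  induction W using Finset.induction_on_max_value key with
  | empty =>
    have hlevel : ∀ u, levelCount X.faces ∅ (u + 1) = 0 := fun u => by simp [levelCount]
    refine ⟨[], .nil (l + 1), by simp, ?_⟩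
    simp only [hlevel, Nat.cast_zero, List.length_nil, sum_empty, add_zero]
    exact map_zero _
  | insert v W hvW hmax ih =>
    obtain ⟨C, hC, hCX, hCcount⟩ := ih fun w hw => hW w (mem_insert_of_mem hw)
    have hv : {v} ∈ X := hW v (mem_insert_self v W)
    obtain ⟨C', hC', hCX', hCcount'⟩ := exists_isAcyclicMatching_of_pairwise (hL v hv).pairwise hl W
    have hvC' : ∀ p ∈ C', v ∉ p.2 := fun p hp h => hvW ((hCX' p hp).1 h)
    refine ⟨C'.map (fun p => (insert v p.1, insert v p.2)) ++ C, (hC'.map_insert hvC').append hC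
      ?_, fun q hq => ?_, ?_⟩
    · refine List.forall_mem_map.2 fun p _ q hq h => hvW ((hCX q hq).1 (h (mem_insert_self v p.1)))
    · rcases List.mem_append.1 hq with hq | hq
      · obtain ⟨p, hp, rfl⟩ := List.mem_map.1 hq
        exact ⟨insert_subset_insert v (hCX' p hp).1,
          (mem_augmentedFaces_link hv (hvC' p hp)).1
            (((hL v hv).mem_iff p.2 ((hC'.card_snd p hp).trans_le hl)).2 (hCX' p hp).2)⟩
      · exact ⟨(hCX q hq).1.trans (subset_insert v W), (hCX q hq).2⟩
    · have hlevel : ∀ u ≤ l, (levelCount X.faces (insert v W) (u + 1) : ℚ) =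
          levelCount X.faces W (u + 1) + levelCount {σ | ∃ I ∈ L v, σ ∈ I} W u := fun u hu => by
        rw [levelCount_faces_insert hv hvW, Nat.cast_add,
          levelCount_congr (G := {σ | _}) fun σ _ hσ => (hL v hv).mem_iff σ (by omega)]
      have hlt : ∀ x ∈ W, key x < key v := fun x hx =>
        lt_of_le_of_ne (hmax x hx) fun h => hvW (hkey h ▸ hx)
      have hbelow : {x ∈ insert v W | key x < key v} = W := by
        rw [filter_insert, if_neg (lt_irrefl _), filter_true_of_mem hlt]
      have hbelow' : ∀ w ∈ W, {x ∈ insert v W | key x < key w} = {x ∈ W | key x < key w} :=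
        fun w hw => by rw [filter_insert, if_neg (hlt w hw).not_gt]
      rw [sum_insert hvW, hbelow, sum_congr rfl fun w hw => by rw [hbelow' w hw],
        altSum_congr hlevel, altSum_add, hCcount, hCcount', List.length_append, List.length_map,
        Nat.cast_add]
      ring

end VertexByVertex

section RandomOrders

variable {V : Type*} [LinearOrder V] {W : Finset V}

theorem mul_swap_mem_permsOfFinset {p : Equiv.Perm V} (hp : p ∈ permsOfFinset W) {u v : V}
    (hu : u ∈ W) (hv : v ∈ W) : p * Equiv.swap u v ∈ permsOfFinset W := by
  rw [mem_perms_of_finset_iff] at hp ⊢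
  intro x hx
  by_cases hxu : x = u
  · exact hxu ▸ hu
  by_cases hxv : x = v
  · exact hxv ▸ hv
  exact hp (by rwa [Equiv.Perm.mul_apply, Equiv.swap_apply_of_ne_of_ne hxu hxv] at hx)

theorem card_isMax_le {T : Finset V} (hT : T ⊆ W) {u v : V} (hu : u ∈ T) (hv : v ∈ T) :
    #{p ∈ permsOfFinset W | ∀ x ∈ T, p x ≤ p u} ≤ #{p ∈ permsOfFinset W | ∀ x ∈ T, p x ≤ p v} := by
  refine card_le_card_of_injOn (· * Equiv.swap u v) (fun p hp => ?_) (mul_left_injective _).injOn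
  obtain ⟨hpW, hpu⟩ := mem_filter.1 hp
  refine mem_filter.2 ⟨mul_swap_mem_permsOfFinset hpW (hT hu) (hT hv), fun x hx => ?_⟩
  rw [Equiv.Perm.mul_apply, Equiv.Perm.mul_apply, Equiv.swap_apply_right]
  refine hpu _ ?_
  rw [Equiv.swap_apply_def]
  split_ifs
  exacts [hv, hu, hx]

theorem card_isMax_mul_card {T : Finset V} (hT : T ⊆ W) {v : V} (hv : v ∈ T) :
    #{p ∈ permsOfFinset W | ∀ x ∈ T, p x ≤ p v} * #T = (#W).factorial := by
  have hconst : ∀ u ∈ T, #{p ∈ permsOfFinset W | ∀ x ∈ T, p x ≤ p u} =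
      #{p ∈ permsOfFinset W | ∀ x ∈ T, p x ≤ p v} := fun u hu =>
    (card_isMax_le hT hu hv).antisymm (card_isMax_le hT hv hu)
  have hunique : ∀ p ∈ permsOfFinset W, #{u ∈ T | ∀ x ∈ T, p x ≤ p u} = 1 := fun p _ => by
    obtain ⟨u, hu, hmax⟩ := exists_max_image T p ⟨v, hv⟩
    refine card_eq_one.2
      ⟨u, eq_singleton_iff_unique_mem.2 ⟨mem_filter.2 ⟨hu, hmax⟩, fun w hw => ?_⟩⟩
    exact p.injective ((hmax w (mem_filter.1 hw).1).antisymm ((mem_filter.1 hw).2 u hu))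
  calc _ = ∑ u ∈ T, #{p ∈ permsOfFinset W | ∀ x ∈ T, p x ≤ p u} := by
        rw [sum_congr rfl hconst, sum_const, smul_eq_mul, mul_comm]
    _ = ∑ p ∈ permsOfFinset W, #{u ∈ T | ∀ x ∈ T, p x ≤ p u} := by
        simp only [card_filter]
        exact sum_comm
    _ = (#W).factorial := by rw [sum_congr rfl hunique, sum_const, smul_eq_mul, mul_one,
        card_perms_of_finset]

theorem card_separates_eq_add {v x : V} (hvx : v ≠ x) (β γ : Finset V) :
    #{p ∈ permsOfFinset W | (∀ y ∈ β, p y < p v) ∧ ∀ y ∈ γ, p v < p y} =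
      #{p ∈ permsOfFinset W | (∀ y ∈ insert x β, p y < p v) ∧ ∀ y ∈ γ, p v < p y} +
      #{p ∈ permsOfFinset W | (∀ y ∈ β, p y < p v) ∧ ∀ y ∈ insert x γ, p v < p y} := by
  rw [← card_filter_add_card_filter_not (fun p : Equiv.Perm V => p x < p v), filter_filter,
    filter_filter]
  refine congr_arg₂ _ (congr_arg card (filter_congr fun p _ => ?_))
    (congr_arg card (filter_congr fun p _ => ?_))
  · rw [forall_mem_insert]
    tauto
  · rw [forall_mem_insert, not_lt, (p.injective.ne hvx : p v ≠ p x).le_iff_lt]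
    tauto

theorem card_separates_mul_factorial {v : V} (hv : v ∈ W) {β γ : Finset V} (hβ : β ⊆ W)
    (hvβ : v ∉ β) (hγ : γ ⊆ W) (hvγ : v ∉ γ) (hβγ : Disjoint β γ) :
    #{p ∈ permsOfFinset W | (∀ x ∈ β, p x < p v) ∧ ∀ x ∈ γ, p v < p x} *
      (#β + #γ + 1).factorial = (#W).factorial * ((#β).factorial * (#γ).factorial) := by
  induction γ using Finset.induction_on generalizing β with
  | empty =>
    have hmax := card_isMax_mul_card (insert_subset hv hβ) (mem_insert_self v β)
    have hiff : ∀ p : Equiv.Perm V, (∀ x ∈ insert v β, p x ≤ p v) ↔ ∀ x ∈ β, p x < p v :=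
      fun p => by
        rw [forall_mem_insert, and_iff_right le_rfl]
        exact forall₂_congr fun x hx =>
          (p.injective.ne fun h => hvβ (h ▸ hx) : p x ≠ p v).le_iff_lt
    simp only [hiff, card_insert_of_notMem hvβ] at hmax
    simp only [notMem_empty, false_imp_iff, implies_true, and_true, card_empty, add_zero,
      Nat.factorial_succ, Nat.factorial_zero, ← hmax]
    ring
  | insert x γ hxγ ih =>
    obtain ⟨hxW, hγ⟩ := insert_subset_iff.1 hγ
    obtain ⟨hvx, hvγ⟩ := not_or.1 (mt mem_insert.2 hvγ)
    obtain ⟨hxβ, hβγ⟩ := disjoint_insert_right.1 hβγ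
    have habove := ih hβ hvβ hγ hvγ hβγ
    have hbelow := ih (insert_subset hxW hβ) (mt mem_insert.1 (not_or.2 ⟨hvx, hvβ⟩)) hγ hvγ
      (disjoint_insert_left.2 ⟨hxγ, hβγ⟩)
    rw [card_separates_eq_add hvx] at habove
    rw [card_insert_of_notMem hxβ, Nat.factorial_succ (#β), add_right_comm (#β),
      Nat.factorial_succ (#β + #γ + 1)] at hbelow
    rw [card_insert_of_notMem hxγ, Nat.factorial_succ (#γ), ← add_assoc (#β),
      Nat.factorial_succ (#β + #γ + 1)]
    zify at habove hbelow ⊢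
    linear_combination (#β + #γ + 1 + 1 : ℤ) * habove - hbelow

theorem inter_below_eq_iff {v : V} {I : NonemptyInterval (Finset V)} (hIW : I.snd ⊆ W)
    (hv : v ∉ I.snd) (p : Equiv.Perm V) : I.snd ∩ {x ∈ W | p x < p v} = I.fst ↔
      (∀ x ∈ I.fst, p x < p v) ∧ ∀ x ∈ I.snd \ I.fst, p v < p x := by
  have hfst : ∀ x ∈ I.fst, x ∈ I.snd := fun x hx => I.fst_le_snd hx
  have hne : ∀ x ∈ I.snd, p x ≠ p v := fun x hx => p.injective.ne fun h => hv (h ▸ hx)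
  simp only [Finset.ext_iff, mem_inter, mem_filter, mem_sdiff]
  refine ⟨fun h => ⟨fun x hx => ((h x).2 hx).2.2, fun x hx => ?_⟩, fun h x => ?_⟩
  · exact (hne x hx.1).symm.lt_of_le (not_lt.1 fun hlt => hx.2 ((h x).1 ⟨hx.1, hIW hx.1, hlt⟩))
  · exact ⟨fun hx => by_contra fun hxI => (h.2 x ⟨hx.1, hxI⟩).asymm hx.2.2,
      fun hx => ⟨hfst x hx, hIW (hfst x hx), h.1 x hx⟩⟩

theorem sum_criticalCount_singleton_mul {v : V} (hv : v ∈ W) {I : NonemptyInterval (Finset V)}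
    (hIW : I.snd ⊆ W) (hvI : v ∉ I.snd) (j : ℕ) :
    (∑ p ∈ permsOfFinset W, criticalCount [I] {x ∈ W | p x < p v} j) *
        ((#I.snd + 1) * (#I.snd).choose j) =
      (#W).factorial * if #I.fst = j then 1 else 0 := by
  simp only [criticalCount_singleton, inter_below_eq_iff hIW hvI]
  split_ifs with hj
  · subst hj
    have hfst : #I.fst ≤ #I.snd := card_le_card I.fst_le_snd
    have hcount := card_separates_mul_factorial hv (subset_trans I.fst_le_snd hIW)
      (fun h => hvI (I.fst_le_snd h)) (sdiff_subset.trans hIW) (notMem_mono sdiff_subset hvI)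
      disjoint_sdiff
    rw [card_sdiff_of_subset I.fst_le_snd, Nat.add_sub_of_le hfst, Nat.factorial_succ,
      ← Nat.choose_mul_factorial_mul_factorial hfst] at hcount
    refine Nat.eq_of_mul_eq_mul_right
      (Nat.mul_pos (#I.fst).factorial_pos (#I.snd - #I.fst).factorial_pos) ?_
    simp only [and_true, ← card_filter]
    linear_combination hcount
  · simp only [hj, and_false, if_false, sum_const_zero, zero_mul, mul_zero]

theorem sum_criticalCount_mul {v : V} (hv : v ∈ W) {L : List (NonemptyInterval (Finset V))} {n : ℕ}
    (hL : ∀ I ∈ L, #I.snd = n ∧ I.snd ⊆ W ∧ v ∉ I.snd) (j : ℕ) :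
    (∑ p ∈ permsOfFinset W, criticalCount L {x ∈ W | p x < p v} j) * ((n + 1) * n.choose j) =
      (#W).factorial * L.countP fun I => #I.fst = j := by
  induction L with
  | nil => simp [criticalCount]
  | cons I L ih =>
    obtain ⟨⟨rfl, hIW, hvI⟩, hL⟩ := List.forall_mem_cons.1 hL
    have hcons : (#W).factorial * (I :: L).countP (fun J => #J.fst = j) =
        (#W).factorial * L.countP (fun J => #J.fst = j) +
          (#W).factorial * if #I.fst = j then 1 else 0 := by
      simp only [List.countP_cons, decide_eq_true_eq, mul_add]
    rw [hcons, ← ih hL, ← sum_criticalCount_singleton_mul hv hIW hvI, ← add_mul,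
      ← sum_add_distrib, sum_congr rfl fun p _ => by rw [criticalCount_cons I L, add_comm]]

end RandomOrders

section FaceNumbers

/-- The transform taking the numbers `f s` of faces with `s` elements to the coefficient of `x ^ j`
in `∑ f s * x ^ s * (1 - x) ^ (n - s)`, for `j ≤ n`. For a complex of dimension `d` it yields the
`h`-numbers if `n = d + 1` and the `g`-numbers if `n = d + 2`. -/
def hTransform (n j : ℕ) : (ℕ → ℤ) →ₗ[ℤ] ℤ :=
  ∑ s ∈ range (j + 1), ((-1) ^ (j - s) * (n - s).choose (j - s) : ℤ) • LinearMap.proj s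

theorem hTransform_apply (n j : ℕ) (f : ℕ → ℤ) : hTransform n j f =
    ∑ s ∈ range (j + 1), (-1) ^ (j - s) * ((n - s).choose (j - s) : ℤ) * f s := by
  simp only [hTransform, LinearMap.sum_apply, LinearMap.smul_apply, LinearMap.proj_apply,
    smul_eq_mul]

theorem hTransform_congr {n j : ℕ} {f g : ℕ → ℤ} (h : ∀ s ≤ j, f s = g s) :
    hTransform n j f = hTransform n j g := by
  rw [hTransform_apply, hTransform_apply]
  exact sum_congr rfl fun s hs => by rw [h s (Nat.lt_succ_iff.1 (mem_range.1 hs))]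

theorem hTransform_succ_succ {n j : ℕ} (hj : j ≤ n) (f : ℕ → ℤ) :
    hTransform (n + 1) (j + 1) f = hTransform n (j + 1) f - hTransform n j f := by
  simp only [hTransform_apply]
  rw [sum_range_succ, sum_range_succ _ (j + 1), add_sub_right_comm, ← sum_sub_distrib]
  congr 1
  · refine sum_congr rfl fun s hs => ?_
    have hs := mem_range.1 hs
    rw [Nat.succ_sub (by omega), Nat.succ_sub (by omega), Nat.choose_succ_succ, pow_succ]
    push_cast
    ring
  · simp only [Nat.sub_self, Nat.choose_zero_right]

theorem hTransform_choose {n b j : ℕ} (hb : b ≤ n) (hj : j ≤ n) :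
    hTransform n j (fun s => (n - b).choose (n - s)) = if b = j then 1 else 0 := by
  have hterm : ∀ s ∈ range (j + 1), (-1) ^ (j - s) * ((n - s).choose (j - s) : ℤ) *
      (n - b).choose (n - s) =
      (n - b).choose (n - j) * ((-1) ^ (j - s) * (j - b).choose (j - s)) := fun s hs => by
    have hsj := Nat.lt_succ_iff.1 (mem_range.1 hs)
    have hmul := Nat.choose_mul (n := n - b) (Nat.sub_le_sub_left hsj n)
    rw [Nat.choose_symm_of_eq_add (show n - s = (n - j) + (j - s) by omega),
      show n - b - (n - j) = j - b by omega, show n - s - (n - j) = j - s by omega] at hmul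
    zify at hmul
    linear_combination (-1 : ℤ) ^ (j - s) * hmul
  have hreflect := sum_range_reflect (fun s => (-1 : ℤ) ^ s * (j - b).choose s) (j + 1)
  rw [Nat.add_sub_cancel] at hreflect
  rw [hTransform_apply, sum_congr rfl hterm, ← mul_sum, hreflect]
  rcases lt_trichotomy b j with hbj | rfl | hbj
  · obtain ⟨m, hm⟩ : ∃ m, j - b = m + 1 := Nat.exists_eq_succ_of_ne_zero (Nat.sub_pos_of_lt hbj).ne'
    rw [hm, Int.alternating_sum_range_choose_eq_choose,
      Nat.choose_eq_zero_of_lt (show m < j by omega),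
      if_neg hbj.ne, Nat.cast_zero, mul_zero, mul_zero]
  · simp [sum_range_succ']
  · rw [Nat.choose_eq_zero_of_lt (by omega), if_neg hbj.ne', Nat.cast_zero, zero_mul]

theorem hTransform_succ_mul {n j : ℕ} (hj : j ≤ n) (f : ℕ → ℤ) :
    hTransform n j (fun s => (s + 1) * f (s + 1)) =
      (j + 1) * hTransform (n + 1) (j + 1) f + (n + 1 - j) * hTransform (n + 1) j f := by
  have hterm : ∀ s ∈ range (j + 1),
      (-1) ^ (j + 1 - s) * ((n + 1 - s).choose (j + 1 - s) : ℤ) * (s * f s) =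
      (j + 1) * ((-1) ^ (j + 1 - s) * ((n + 1 - s).choose (j + 1 - s) : ℤ) * f s) +
        (n + 1 - j) * ((-1) ^ (j - s) * ((n + 1 - s).choose (j - s) : ℤ) * f s) := fun s hs => by
    have hs := mem_range.1 hs
    have hchoose := Nat.choose_succ_right_eq (n + 1 - s) (j - s)
    rw [show n + 1 - s - (j - s) = n + 1 - j by omega] at hchoose
    rw [show j + 1 - s = j - s + 1 by omega, pow_succ]
    zify [show s ≤ j by omega, show j ≤ n + 1 by omega] at hchoose
    linear_combination (-1 : ℤ) ^ (j - s) * f s * hchoose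
  calc hTransform n j (fun s => (s + 1) * f (s + 1))
      = ∑ s ∈ range (j + 2), (-1) ^ (j + 1 - s) * ((n + 1 - s).choose (j + 1 - s) : ℤ) *
          (s * f s) := by
        rw [hTransform_apply, sum_range_succ' _ (j + 1)]
        simp only [Nat.add_sub_add_right, Nat.cast_add, Nat.cast_one, Nat.cast_zero, zero_mul,
          mul_zero, add_zero]
    _ = _ := by
        simp only [hTransform_apply]
        rw [sum_range_succ, sum_range_succ _ (j + 1), sum_congr rfl hterm, sum_add_distrib, mul_add,
          mul_sum, mul_sum]
        simp only [Nat.sub_self, Nat.choose_zero_right, pow_zero]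
        push_cast
        ring

variable {V : Type*}

theorem gNumber_eq_hTransform (X : PreAbstractSimplicialComplex V) {d j : ℕ} (hj : j ≤ d + 1) :
    X.gNumber d j = hTransform (d + 2) j (fun s => X.faceCount s) := by
  have hNumber_eq : ∀ i, X.hNumber d i = hTransform (d + 1) i (fun s => X.faceCount s) :=
    fun i => (hTransform_apply _ _ _).symm
  cases j with
  | zero => simp [gNumber, hNumber_eq, hTransform_apply]
  | succ j => rw [gNumber, hNumber_eq, hNumber_eq, ← hTransform_succ_succ (by omega)]

theorem exists_vertexFinset {X : PreAbstractSimplicialComplex V} (hX : X.faces.Finite) :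
    ∃ W : Finset V, ∀ v, v ∈ W ↔ {v} ∈ X := by
  have hfinite : {v : V | {v} ∈ X}.Finite := hX.preimage singleton_injective.injOn
  exact ⟨hfinite.toFinset, fun v => hfinite.mem_toFinset⟩

theorem faceCount_succ {X : PreAbstractSimplicialComplex V} {W : Finset V}
    (hW : ∀ v, v ∈ W ↔ {v} ∈ X) (u : ℕ) :
    X.faceCount (u + 1) = levelCount X.faces W (u + 1) := by
  classical
  rw [faceCount, if_neg u.succ_ne_zero, levelCount, ← Set.ncard_coe_finset]
  congr 1
  ext σ
  simp only [coe_filter, mem_powersetCard, Set.mem_ofPred_eq]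
  exact ⟨fun ⟨hσ, hcard⟩ => ⟨⟨fun v hv => (hW v).2 (singleton_mem_of_mem hσ hv), hcard⟩, hσ⟩,
    fun ⟨⟨_, hcard⟩, hσ⟩ => ⟨hσ, hcard⟩⟩

theorem levelCount_interval {I : NonemptyInterval (Finset V)} {A : Finset V} (hA : I.snd ⊆ A)
    {u : ℕ} (hu : u ≤ #I.snd) :
    levelCount {σ | σ ∈ I} A u = (#I.snd - #I.fst).choose (#I.snd - u) := by
  classical
  have hfst : #I.fst ≤ #I.snd := card_le_card I.fst_le_snd
  have hfilter : levelCount {σ | σ ∈ I} A u = #{σ ∈ I.snd.powersetCard u | I.fst ⊆ σ} := by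
    refine congr_arg card ?_
    ext σ
    simp only [mem_filter, mem_powersetCard, Set.mem_ofPred_eq, NonemptyInterval.mem_def]
    exact ⟨fun ⟨⟨_, hcard⟩, hfst, hsnd⟩ => ⟨⟨hsnd, hcard⟩, hfst⟩,
      fun ⟨⟨hsnd, hcard⟩, hfst⟩ => ⟨⟨hsnd.trans hA, hcard⟩, hfst, hsnd⟩⟩
  rcases le_or_gt #I.fst u with hu' | hu'
  · rw [hfilter, card_filter_powersetCard_subset _ _ _ I.fst_le_snd hu']
    exact Nat.choose_symm_of_eq_add (by omega)
  · rw [Nat.choose_eq_zero_of_lt (by omega)]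
    exact levelCount_eq_zero fun σ _ hσ hσI => ((card_le_card hσI.1).trans_eq hσ).not_gt hu'

theorem hTransform_levelCount {L : List (NonemptyInterval (Finset V))} {A : Finset V} {n c j : ℕ}
    (hL : L.Pairwise fun I J => ∀ σ ∈ J, #σ ≤ c → ¬ I.fst ⊆ σ)
    (hLA : ∀ I ∈ L, #I.snd = n ∧ I.snd ⊆ A) (hjc : j ≤ c) (hjn : j ≤ n) :
    hTransform n j (fun u => levelCount {σ | ∃ I ∈ L, σ ∈ I} A u) =
      L.countP fun I => #I.fst = j := by
  induction L with
  | nil => simp [hTransform_apply, levelCount]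
  | cons I L ih =>
    obtain ⟨hI, hL⟩ := List.pairwise_cons.1 hL
    obtain ⟨⟨rfl, hIA⟩, hLA⟩ := List.forall_mem_cons.1 hLA
    have hlevel : ∀ u ≤ j, (levelCount {σ | ∃ J ∈ I :: L, σ ∈ J} A u : ℤ) =
        (#I.snd - #I.fst).choose (#I.snd - u) + levelCount {σ | ∃ J ∈ L, σ ∈ J} A u :=
      fun u hu => by
        rw [← levelCount_interval hIA (hu.trans hjn)]
        exact_mod_cast levelCount_cons hI A (hu.trans hjc)
    have hadd := map_add (hTransform #I.snd j)
      (fun u => ((#I.snd - #I.fst).choose (#I.snd - u) : ℤ))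
      (fun u => (levelCount {σ | ∃ J ∈ L, σ ∈ J} A u : ℤ))
    rw [hTransform_congr hlevel, List.countP_cons]
    refine hadd.trans ?_
    rw [hTransform_choose (card_le_card I.fst_le_snd) hjn, ih hL hLA, add_comm]
    push_cast
    simp only [decide_eq_true_eq]

variable [DecidableEq V]

theorem levelCount_link {X : PreAbstractSimplicialComplex V} {W : Finset V} {v : V} (hv : v ∈ W)
    (hvX : {v} ∈ X) (u : ℕ) : levelCount (augmentedFaces (X.link v)) (W.erase v) u =
      levelCount {σ | σ ∈ X ∧ v ∈ σ} W (u + 1) := by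
  have hins := levelCount_insert {σ | σ ∈ X ∧ v ∈ σ} (notMem_erase v W) u
  have hzero : levelCount {σ | σ ∈ X ∧ v ∈ σ} (W.erase v) (u + 1) = 0 :=
    levelCount_eq_zero fun σ hσ _ h => notMem_erase v W (hσ h.2)
  rw [insert_erase hv, hzero, zero_add] at hins
  refine Eq.trans (levelCount_congr fun σ hσ _ => ?_) hins.symm
  rw [mem_augmentedFaces_link hvX (notMem_mono hσ (notMem_erase v W))]
  exact (and_iff_left (mem_insert_self v σ)).symm

theorem sum_levelCount_link {X : PreAbstractSimplicialComplex V} {W : Finset V}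
    (hW : ∀ v ∈ W, {v} ∈ X) (u : ℕ) :
    ∑ v ∈ W, levelCount (augmentedFaces (X.link v)) (W.erase v) u =
      (u + 1) * levelCount X.faces W (u + 1) := by
  classical
  set S := {σ ∈ W.powersetCard (u + 1) | σ ∈ X.faces} with hS
  have hlink : ∀ v ∈ W, levelCount (augmentedFaces (X.link v)) (W.erase v) u =
      #(S.bipartiteAbove (fun v σ => v ∈ σ) v) := fun v hv => by
    rw [levelCount_link hv (hW v hv), bipartiteAbove, hS, filter_filter, levelCount]
    exact congr_arg card (filter_congr_decidable ..)
  have hcard : ∀ σ ∈ S, #(W.bipartiteBelow (fun v σ => v ∈ σ) σ) = u + 1 := fun σ hσ => by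
    have hσ := mem_powersetCard.1 (mem_filter.1 hσ).1
    rw [bipartiteBelow, filter_mem_eq_inter, inter_eq_right.2 hσ.1, hσ.2]
  rw [sum_congr rfl hlink, sum_card_bipartiteAbove_eq_sum_card_bipartiteBelow, sum_congr rfl hcard,
    sum_const, smul_eq_mul, mul_comm, levelCount]

theorem IsSkeletonShelling.snd_subset_erase {X : PreAbstractSimplicialComplex V} {d k c : ℕ} {v : V}
    {L : List (NonemptyInterval (Finset V))} (hL : IsSkeletonShelling (X.link v) d k c L)
    {W : Finset V} (hW : ∀ x, {x} ∈ X → x ∈ W) : ∀ I ∈ L, I.snd ⊆ W.erase v := fun I hI x hx => by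
  have hx := hL.singleton_mem I hI x hx
  exact mem_erase.2 ⟨fun h => hx.2.1 (mem_singleton.2 h.symm),
    hW x (singleton_mem_of_mem hx.2.2 (mem_insert_of_mem (mem_singleton_self x)))⟩

theorem sum_countP_links {X : PreAbstractSimplicialComplex V} {d k c j : ℕ} {W : Finset V}
    {L : V → List (NonemptyInterval (Finset V))} (hW : ∀ v, v ∈ W ↔ {v} ∈ X)
    (hL : ∀ v, {v} ∈ X → IsSkeletonShelling (X.link v) d k c (L v)) (hjc : j ≤ c) (hjd : j ≤ d) :
    (∑ v ∈ W, (L v).countP fun I => #I.fst = j : ℤ) =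
      (j + 1) * X.gNumber d (j + 1) + (d + 2 - j) * X.gNumber d j := by
  have hlink : ∀ v ∈ W, ((L v).countP fun I => #I.fst = j : ℤ) =
      hTransform (d + 1) j (fun u => levelCount (augmentedFaces (X.link v)) (W.erase v) u) :=
    fun v hv => by
      have hvL := hL v ((hW v).1 hv)
      rw [← hTransform_levelCount hvL.pairwise (fun I hI => ⟨hvL.card_snd I hI,
        hvL.snd_subset_erase (fun x => (hW x).2) I hI⟩) hjc (by omega)]
      refine hTransform_congr fun u hu => congr_arg Nat.cast (levelCount_congr fun σ _ hσ => ?_)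
      exact (hvL.mem_iff σ (by omega)).symm
  have hfaces : ∀ u, ∑ v ∈ W, (levelCount (augmentedFaces (X.link v)) (W.erase v) u : ℤ) =
      (u + 1) * X.faceCount (u + 1) := fun u => by
    rw [faceCount_succ hW]
    exact_mod_cast sum_levelCount_link (fun v => (hW v).1) u
  rw [sum_congr rfl hlink, ← map_sum, gNumber_eq_hTransform X (by omega),
    gNumber_eq_hTransform X (by omega)]
  refine (hTransform_congr fun u _ => ?_).trans
    ((hTransform_succ_mul (by omega) fun s => (X.faceCount s : ℤ)).trans ?_)
  · rw [Finset.sum_apply, hfaces]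
  · push_cast
    ring

end FaceNumbers

section Averaging

variable {V : Type*}

/-- The number `g_j / C(d + 2, j)` of a complex of dimension `d`. -/
noncomputable def normalizedG (X : PreAbstractSimplicialComplex V) (d j : ℕ) : ℚ :=
  X.gNumber d j / (d + 2).choose j

theorem normalizedG_zero (X : PreAbstractSimplicialComplex V) (d : ℕ) : normalizedG X d 0 = 1 := by
  simp [normalizedG, gNumber, hNumber, faceCount]

theorem gNumber_eq_choose_mul (X : PreAbstractSimplicialComplex V) {d j : ℕ} (hj : j ≤ d + 2) :
    (X.gNumber d j : ℚ) = (d + 2).choose j * normalizedG X d j :=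
  (mul_div_cancel₀ _ (Nat.cast_ne_zero.2 (Nat.choose_pos hj).ne')).symm

theorem succ_mul_gNumber_add (X : PreAbstractSimplicialComplex V) {d j : ℕ} (hj : j ≤ d) :
    ((j + 1) * X.gNumber d (j + 1) + (d + 2 - j) * X.gNumber d j : ℚ) =
      (d + 2) * (d + 1).choose j * (normalizedG X d (j + 1) + normalizedG X d j) := by
  have hsucc : ((d + 2) * (d + 1).choose j : ℚ) = (d + 2).choose (j + 1) * (j + 1) := by
    exact_mod_cast Nat.add_one_mul_choose_eq (d + 1) j
  have hsame : ((d + 1).choose j * (d + 2) : ℚ) = (d + 2).choose j * (d + 2 - j) := by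
    have h := Nat.choose_mul_succ_eq (d + 1) j
    zify [show j ≤ d + 1 + 1 by omega] at h
    exact_mod_cast h
  rw [gNumber_eq_choose_mul X (by omega), gNumber_eq_choose_mul X (by omega)]
  linear_combination -normalizedG X d (j + 1) * hsucc - normalizedG X d j * hsame

variable [LinearOrder V] {X : PreAbstractSimplicialComplex V} {d k c : ℕ}

theorem sum_criticalCount_links {W : Finset V} {L : V → List (NonemptyInterval (Finset V))} {j : ℕ}
    (hW : ∀ v, v ∈ W ↔ {v} ∈ X)
    (hL : ∀ v, {v} ∈ X → IsSkeletonShelling (X.link v) d k c (L v)) (hjc : j ≤ c) (hjd : j ≤ d) :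
    ∑ p ∈ permsOfFinset W, ∑ v ∈ W, (criticalCount (L v) {x ∈ W | p x < p v} j : ℚ) =
      (#W).factorial * (normalizedG X d (j + 1) + normalizedG X d j) := by
  have hpos : 0 < (d + 2) * (d + 1).choose j :=
    Nat.mul_pos (by omega) (Nat.choose_pos (by omega))
  have hv : ∀ v ∈ W, (∑ p ∈ permsOfFinset W, criticalCount (L v) {x ∈ W | p x < p v} j) *
      ((d + 2) * (d + 1).choose j) = (#W).factorial * (L v).countP fun I => #I.fst = j :=
    fun v hv => by
      have hvL := hL v ((hW v).1 hv)
      refine sum_criticalCount_mul hv (fun I hI => ?_) j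
      have hsub := hvL.snd_subset_erase (fun x => (hW x).2) I hI
      exact ⟨hvL.card_snd I hI, hsub.trans (erase_subset v W),
        notMem_mono hsub (notMem_erase v W)⟩
  have hlinks : (∑ v ∈ W, (L v).countP fun I => #I.fst = j : ℚ) =
      (d + 2) * (d + 1).choose j * (normalizedG X d (j + 1) + normalizedG X d j) := by
    rw [← succ_mul_gNumber_add X hjd]
    exact_mod_cast sum_countP_links hW hL hjc hjd
  have hsum := sum_congr rfl hv
  rw [← sum_mul, ← mul_sum, sum_comm] at hsum
  refine mul_right_cancel₀ (Nat.cast_ne_zero.2 hpos.ne') ?_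
  calc _ = (#W).factorial * (∑ v ∈ W, (L v).countP fun I => #I.fst = j : ℚ) := by
        exact_mod_cast hsum
    _ = _ := by
        rw [hlinks]
        push_cast
        ring

theorem exists_isSkeletonShelling_links (hX : X.IsW k d) (hc : 1 ≤ c) (hck : c + k ≤ d) :
    ∃ L : V → List (NonemptyInterval (Finset V)),
      ∀ v, {v} ∈ X → IsSkeletonShelling (X.link v) d k c (L v) := by
  have hex : ∀ v, ∃ L, {v} ∈ X → IsSkeletonShelling (X.link v) d k c L := fun v => by
    by_cases hv : {v} ∈ X
    · have : Nonempty V := ⟨v⟩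
      obtain ⟨L, hL⟩ := exists_isSkeletonShelling (hX.link v hv) hc hck
      exact ⟨L, fun _ => hL⟩
    · exact ⟨[], fun h => absurd h hv⟩
  choose L hL using hex
  exact ⟨L, hL⟩

theorem normalizedG_succ_add_eq_zero (hX : X.IsW k d) {j : ℕ} (hkj : k < j) (hjd : j + k ≤ d) :
    normalizedG X d (j + 1) + normalizedG X d j = 0 := by
  obtain ⟨L, hL⟩ := exists_isSkeletonShelling_links hX (by omega) hjd
  obtain ⟨W, hW⟩ := exists_vertexFinset hX.finite
  have hzero : ∀ v ∈ W, ∀ A, criticalCount (L v) A j = 0 := fun v hv A =>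
    List.countP_eq_zero.2 fun I hI h =>
      ((hL v ((hW v).1 hv)).card_fst_le I hI).not_gt ((of_decide_eq_true h).2 ▸ hkj)
  have hsum := sum_criticalCount_links hW hL le_rfl (by omega)
  rw [sum_eq_zero fun p _ => sum_eq_zero fun v hv => by rw [hzero v hv, Nat.cast_zero]] at hsum
  exact (mul_eq_zero.1 hsum.symm).resolve_left (Nat.cast_ne_zero.2 (Nat.factorial_ne_zero _))

theorem altSum_faceCount_sub_le (hX : X.IsW k d) {l r : ℕ} (hl : l + k + 1 ≤ d)
    (hr : ∀ C, IsAcyclicMatching (l + 1) C → (∀ p ∈ C, p.2 ∈ X) → C.length ≤ r) :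
    altSum l (fun u => (X.faceCount (u + 1) : ℚ)) - r ≤ normalizedG X d (l + 1) + (-1) ^ l := by
  obtain ⟨L, hL⟩ := exists_isSkeletonShelling_links hX (c := l + 1) (by omega) (by omega)
  obtain ⟨W, hW⟩ := exists_vertexFinset hX.finite
  have hmorse : ∀ p ∈ permsOfFinset W, altSum l (fun u => (X.faceCount (u + 1) : ℚ)) - r ≤
      altSum l (fun u => ∑ v ∈ W, (criticalCount (L v) {x ∈ W | p x < p v} u : ℚ)) := fun p _ => by
    obtain ⟨C, hC, hCX, hcount⟩ :=
      exists_isAcyclicMatching_of_links hL le_rfl p.injective W fun v => (hW v).1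
    have hlength : (C.length : ℚ) ≤ r := Nat.cast_le.2 (hr C hC fun q hq => (hCX q hq).2)
    simp only [faceCount_succ hW, hcount, ← sum_fn, map_sum]
    linarith
  have haverage : altSum l (fun u => ∑ p ∈ permsOfFinset W, ∑ v ∈ W,
      (criticalCount (L v) {x ∈ W | p x < p v} u : ℚ)) =
      (#W).factorial * (normalizedG X d (l + 1) + (-1) ^ l) := by
    rw [altSum_congr fun u hu => sum_criticalCount_links hW hL (by omega) (by omega),
      altSum_eq_of_consecutive (b := fun u => (#W).factorial * normalizedG X d (u + 1))
        (e := ((#W).factorial : ℚ)) _ fun u _ => mul_add _ _ _]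
    · ring
    · rw [normalizedG_zero, mul_add, mul_one]
  have hsum := sum_le_sum hmorse
  rw [sum_const, card_perms_of_finset, nsmul_eq_mul, ← map_sum, sum_fn, haverage] at hsum
  exact le_of_mul_le_mul_left hsum (Nat.cast_pos.2 (Nat.factorial_pos _))

end Averaging

section Homology

variable {V : Type*}

theorem finrank_map_add_finrank_inf_ker {F C D : Type*} [Field F] [AddCommGroup C] [Module F C]
    [AddCommGroup D] [Module F D] (f : C →ₗ[F] D) (S : Submodule F C) [FiniteDimensional F S] :
    Module.finrank F (S.map f) + Module.finrank F (S ⊓ LinearMap.ker f : Submodule F C) =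
      Module.finrank F S := by
  rw [← LinearMap.finrank_range_add_finrank_ker (f.domRestrict S), LinearMap.range_domRestrict,
    LinearMap.ker_domRestrict, ← Submodule.finrank_map_subtype_eq, Submodule.map_comap_subtype]

theorem quotientDim_add_finrank {F C : Type*} [Field F] [AddCommGroup C] [Module F C]
    {Z B : Submodule F C} (hBZ : B ≤ Z) [FiniteDimensional F Z] :
    quotientDim Z B + Module.finrank F B = Module.finrank F Z := by
  rw [quotientDim, ← (Submodule.submoduleOfEquivOfLe hBZ).finrank_eq]
  exact Submodule.finrank_quotient_add_finrank _

variable (F : Type*) [Field F] {X : PreAbstractSimplicialComplex V}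

theorem finiteDimensional_chains (hX : X.faces.Finite) (i : ℕ) :
    FiniteDimensional F (X.chains F i) := by
  have : Finite {σ : Finset V | σ ∈ X ∧ #σ = i + 1} := hX.subset fun _ h => h.1
  exact Module.Finite.equiv (Finsupp.supportedEquivFinsupp (M := F) (R := F) _).symm

theorem finrank_chains (hX : X.faces.Finite) (i : ℕ) :
    Module.finrank F (X.chains F i) = X.faceCount (i + 1) := by
  have : Fintype {σ : Finset V | σ ∈ X ∧ #σ = i + 1} := (hX.subset fun _ h => h.1).fintype
  rw [chains, (Finsupp.supportedEquivFinsupp _).finrank_eq, Module.finrank_finsupp_self,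
    faceCount, if_neg i.succ_ne_zero, Set.ncard_eq_toFinset_card', Set.toFinset_card]

variable [LinearOrder V]

theorem boundaryMap_single (σ : Finset V) (a : F) :
    boundaryMap V F (Finsupp.single σ a) =
      a • ∑ v ∈ σ, Finsupp.single (σ.erase v) ((-1 : F) ^ #{x ∈ σ | x < v}) :=
  Finsupp.linearCombination_single F a σ

theorem boundaryMap_single_singleton (v : V) (a : F) :
    boundaryMap V F (Finsupp.single {v} a) = Finsupp.single ∅ a := by
  rw [boundaryMap_single, sum_singleton, erase_singleton, filter_singleton, if_neg (lt_irrefl v),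
    card_empty, pow_zero, Finsupp.smul_single_one]

theorem boundaryMap_single_pair {v w : V} (h : v < w) (a : F) :
    boundaryMap V F (Finsupp.single {v, w} a) = Finsupp.single {w} a - Finsupp.single {v} a := by
  rw [boundaryMap_single, sum_pair h.ne, erase_insert (notMem_singleton.2 h.ne), pair_comm,
    erase_insert (notMem_singleton.2 h.ne')]
  simp [filter_insert, filter_singleton, h, h.not_gt, sub_eq_add_neg]

theorem sign_mul_sign_erase_add_swap {σ : Finset V} {v w : V} (hv : v ∈ σ) (hvw : v < w) :
    (-1 : F) ^ #{x ∈ σ | x < v} * (-1) ^ #{x ∈ σ.erase v | x < w} +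
      (-1) ^ #{x ∈ σ | x < w} * (-1) ^ #{x ∈ σ.erase w | x < v} = 0 := by
  have hbelow_v : {x ∈ σ.erase w | x < v} = {x ∈ σ | x < v} := by
    rw [filter_erase, erase_eq_of_notMem (a := w) fun h => hvw.not_gt (mem_filter.1 h).2]
  have hbelow_w : #{x ∈ σ.erase v | x < w} + 1 = #{x ∈ σ | x < w} := by
    rw [filter_erase]
    exact card_erase_add_one (mem_filter.2 ⟨hv, hvw⟩)
  rw [hbelow_v, ← hbelow_w, pow_succ]
  ring

theorem boundaryMap_boundaryMap_single (σ : Finset V) (a : F) :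
    boundaryMap V F (boundaryMap V F (Finsupp.single σ a)) =
      a • ∑ p ∈ σ.sigma fun v => σ.erase v, Finsupp.single ((σ.erase p.1).erase p.2)
        ((-1 : F) ^ #{x ∈ σ | x < p.1} * (-1) ^ #{x ∈ σ.erase p.1 | x < p.2}) := by
  simp only [boundaryMap_single, map_sum, smul_sum, Finsupp.smul_single, smul_eq_mul, sum_sigma,
    mul_assoc]

theorem boundaryMap_comp_boundaryMap : boundaryMap V F ∘ₗ boundaryMap V F = 0 := by
  refine Finsupp.lhom_ext fun σ a => ?_
  rw [LinearMap.comp_apply, boundaryMap_boundaryMap_single, LinearMap.zero_apply]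
  refine smul_eq_zero_of_right a <|
    sum_involution (fun p _ => ⟨p.2, p.1⟩) (fun p hp => ?_) (fun p hp _ h => ?_) (fun p hp => ?_)
      fun p _ => rfl
  all_goals obtain ⟨hv, hw⟩ := mem_sigma.1 hp
  · rw [erase_right_comm, ← Finsupp.single_add]
    rcases lt_or_gt_of_ne (ne_of_mem_erase hw) with h | h
    · rw [add_comm, sign_mul_sign_erase_add_swap F (mem_of_mem_erase hw) h, Finsupp.single_zero]
    · rw [sign_mul_sign_erase_add_swap F hv h, Finsupp.single_zero]
  · exact ne_of_mem_erase hw (congr_arg Sigma.fst h)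
  · exact mem_sigma.2 ⟨mem_of_mem_erase hw, mem_erase.2 ⟨(ne_of_mem_erase hw).symm, hv⟩⟩

theorem boundaryMap_single_apply_eq_zero {σ τ : Finset V} (h : ¬ σ ⊆ τ) (a : F) :
    boundaryMap V F (Finsupp.single τ a) σ = 0 := by
  rw [boundaryMap_single, Finsupp.smul_apply, Finsupp.finsetSum_apply]
  refine smul_eq_zero_of_right a (sum_eq_zero fun v _ => Finsupp.single_eq_of_ne ?_)
  rintro rfl
  exact h (erase_subset v τ)

theorem boundaryMap_single_insert_apply {σ : Finset V} {v : V} (hv : v ∉ σ) (a : F) :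
    boundaryMap V F (Finsupp.single (insert v σ) a) σ = a * (-1) ^ #{x ∈ insert v σ | x < v} := by
  rw [boundaryMap_single, Finsupp.smul_apply, Finsupp.finsetSum_apply,
    sum_eq_single_of_mem v (mem_insert_self v σ), erase_insert hv, Finsupp.single_eq_same,
    smul_eq_mul]
  refine fun w _ hwv => Finsupp.single_eq_of_ne fun h => ?_
  exact hv (h ▸ mem_erase.2 ⟨hwv.symm, mem_insert_self v σ⟩)

theorem IsAcyclicMatching.linearIndependent {s : ℕ} {C : List (Finset V × Finset V)}
    (hC : IsAcyclicMatching s C) : LinearIndependent F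
      fun i : Fin C.length => boundaryMap V F (Finsupp.single (C.get i).2 1) := by
  induction C with
  | nil =>
    have : IsEmpty (Fin ([] : List (Finset V × Finset V)).length) := Fin.isEmpty
    exact linearIndependent_empty_type
  | cons p C ih =>
    obtain ⟨hp, hpairwise⟩ := List.pairwise_cons.1 hC.pairwise
    have htail : IsAcyclicMatching s C :=
      ⟨fun q hq => hC.subset q (.tail p hq), fun q hq => hC.card_fst q (.tail p hq),
        fun q hq => hC.card_snd q (.tail p hq), hpairwise⟩
    have hcons : (fun i : Fin (p :: C).length =>
        boundaryMap V F (Finsupp.single ((p :: C).get i).2 1)) =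
        Fin.cons (boundaryMap V F (Finsupp.single p.2 1))
          fun i : Fin C.length => boundaryMap V F (Finsupp.single (C.get i).2 1) :=
      funext fun i => Fin.cases rfl (fun _ => rfl) i
    rw [hcons]
    refine linearIndependent_finCons.2 ⟨ih htail, fun hmem => ?_⟩
    -- The coefficient of `p.1` vanishes in all boundaries but the first one.
    have hcoeff : Submodule.span F (Set.range fun i : Fin C.length =>
        boundaryMap V F (Finsupp.single (C.get i).2 1)) ≤
        LinearMap.ker (Finsupp.lapply (R := F) p.1 : (Finset V →₀ F) →ₗ[F] F) := by
      rw [Submodule.span_le]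
      rintro _ ⟨i, rfl⟩
      exact boundaryMap_single_apply_eq_zero F (hp _ (List.get_mem C i)) 1
    obtain ⟨v, hv, hvp⟩ : ∃ v ∉ p.1, insert v p.1 = p.2 :=
      exists_eq_insert_iff.2 ⟨hC.subset p (.head C),
        by rw [hC.card_fst p (.head C), hC.card_snd p (.head C)]⟩
    have hzero : boundaryMap V F (Finsupp.single p.2 1) p.1 = 0 := hcoeff hmem
    rw [← hvp, boundaryMap_single_insert_apply F hv, one_mul] at hzero
    exact pow_ne_zero _ (neg_ne_zero.2 one_ne_zero) hzero

theorem IsAcyclicMatching.length_le_finrank_boundaries {l : ℕ} {C : List (Finset V × Finset V)}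
    (hC : IsAcyclicMatching (l + 1) C) (hX : X.faces.Finite) (hCX : ∀ p ∈ C, p.2 ∈ X) :
    C.length ≤ Module.finrank F (X.boundaries F l) := by
  have := finiteDimensional_chains F hX (l + 1)
  have : FiniteDimensional F (X.boundaries F l) := Module.Finite.map _ _
  rw [← Fintype.card_fin C.length, ← finrank_span_eq_card (hC.linearIndependent F)]
  refine Submodule.finrank_mono (Submodule.span_le.2 ?_)
  rintro _ ⟨i, rfl⟩
  have hi := List.get_mem C i
  exact Submodule.mem_map_of_mem (Finsupp.single_mem_supported F _ ⟨hCX _ hi, hC.card_snd _ hi⟩)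

theorem boundaries_le_chains (i : ℕ) : X.boundaries F i ≤ X.chains F i := by
  rw [boundaries, chains, Finsupp.supported_eq_span_single, Submodule.map_span, Submodule.span_le]
  rintro _ ⟨_, ⟨σ, ⟨hσ, hσcard⟩, rfl⟩, rfl⟩
  rw [SetLike.mem_coe, boundaryMap_single, one_smul]
  refine Submodule.sum_mem _ fun v hv => Finsupp.single_mem_supported F _ ?_
  have hcard : #(σ.erase v) = i + 1 := by rw [card_erase_of_mem hv, hσcard, Nat.add_sub_cancel]
  exact ⟨mem_of_subset_of_mem hσ (erase_subset v σ) (card_pos.1 (by omega)), hcard⟩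

theorem boundaries_le_ker (i : ℕ) : X.boundaries F i ≤ LinearMap.ker (boundaryMap V F) := by
  rintro _ ⟨x, -, rfl⟩
  exact LinearMap.congr_fun (boundaryMap_comp_boundaryMap F) x

theorem betti_zero_add (hX : X.faces.Finite) :
    X.betti F 0 + Module.finrank F (X.boundaries F 0) = X.faceCount 1 := by
  have := finiteDimensional_chains F hX 0
  rw [← finrank_chains F hX 0]
  exact quotientDim_add_finrank (Z := X.chains F 0) (boundaries_le_chains F 0)

theorem betti_succ_add (hX : X.faces.Finite) (i : ℕ) :
    X.betti F (i + 1) + Module.finrank F (X.boundaries F (i + 1)) +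
      Module.finrank F (X.boundaries F i) = X.faceCount (i + 2) := by
  have := finiteDimensional_chains F hX (i + 1)
  have : FiniteDimensional F (X.cycles F (i + 1)) := Submodule.finiteDimensional_inf_left _ _
  have hle : X.boundaries F (i + 1) ≤ X.cycles F (i + 1) :=
    le_inf (boundaries_le_chains F _) (boundaries_le_ker F _)
  rw [← finrank_chains F hX,
    ← finrank_map_add_finrank_inf_ker (boundaryMap V F) (X.chains F (i + 1)),
    show X.betti F (i + 1) = quotientDim (X.cycles F (i + 1)) (X.boundaries F (i + 1)) from rfl,
    quotientDim_add_finrank hle, add_comm]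
  rfl

theorem altSum_betti (hX : X.faces.Finite) (l : ℕ) :
    altSum l (fun i => (X.betti F i : ℚ)) =
      altSum l (fun u => (X.faceCount (u + 1) : ℚ)) - Module.finrank F (X.boundaries F l) := by
  induction l with
  | zero =>
    rw [altSum_zero, altSum_zero, ← betti_zero_add F hX, Nat.cast_add, add_sub_cancel_right]
  | succ l ih =>
    rw [altSum_succ, altSum_succ, ih, ← betti_succ_add F hX]
    push_cast
    ring

theorem single_sub_single_mem_boundaries {v w : V} (h : {v, w} ∈ X) :
    Finsupp.single {w} 1 - Finsupp.single {v} 1 ∈ X.boundaries F 0 := by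
  rcases lt_trichotomy v w with hvw | rfl | hwv
  · rw [← boundaryMap_single_pair F hvw]
    exact Submodule.mem_map_of_mem (Finsupp.single_mem_supported F _ ⟨h, card_pair hvw.ne⟩)
  · rw [sub_self]
    exact zero_mem _
  · rw [← neg_mem_iff, neg_sub, ← boundaryMap_single_pair F hwv, pair_comm]
    exact Submodule.mem_map_of_mem (Finsupp.single_mem_supported F _ ⟨h, card_pair hwv.ne'⟩)

theorem chains_zero_le_span_sup_boundaries (hX : X.Connected) {v : V} (hv : {v} ∈ X) :
    X.chains F 0 ≤ F ∙ (Finsupp.single {v} 1 : Finset V →₀ F) ⊔ X.boundaries F 0 := by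
  have hpath : ∀ w, Relation.ReflTransGen (fun a b : V => ({a, b} : Finset V) ∈ X) v w →
      Finsupp.single {w} 1 - Finsupp.single {v} 1 ∈ X.boundaries F 0 := fun w h => by
    induction h with
    | refl => rw [sub_self]; exact zero_mem _
    | tail _ hedge ih =>
      rw [← sub_add_sub_cancel]
      exact add_mem (single_sub_single_mem_boundaries F hedge) ih
  rw [chains, Finsupp.supported_eq_span_single, Submodule.span_le]
  rintro _ ⟨σ, ⟨hσ, hσcard⟩, rfl⟩
  obtain ⟨w, rfl⟩ := card_eq_one.1 hσcard
  exact Submodule.mem_sup.2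
    ⟨_, Submodule.mem_span_singleton_self _, _, hpath w (hX.2 v w hv hσ), add_sub_cancel _ _⟩

-- On vertices `boundaryMap` is the augmentation, with the empty face as the basis of its target.
theorem map_chains_zero {v : V} (hv : {v} ∈ X) :
    (X.chains F 0).map (boundaryMap V F) = F ∙ (Finsupp.single ∅ 1 : Finset V →₀ F) := by
  rw [chains, Finsupp.supported_eq_span_single, Submodule.map_span]
  refine le_antisymm (Submodule.span_le.2 ?_) ((Submodule.span_singleton_le_iff_mem _ _).2 ?_)
  · rintro _ ⟨_, ⟨σ, ⟨-, hσcard⟩, rfl⟩, rfl⟩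
    obtain ⟨w, rfl⟩ := card_eq_one.1 hσcard
    rw [boundaryMap_single_singleton]
    exact Submodule.mem_span_singleton_self _
  · rw [← boundaryMap_single_singleton F v]
    exact Submodule.subset_span ⟨_, ⟨{v}, ⟨hv, card_singleton v⟩, rfl⟩, rfl⟩

theorem chains_zero_inf_ker (hX : X.Connected) :
    X.chains F 0 ⊓ LinearMap.ker (boundaryMap V F) = X.boundaries F 0 := by
  refine le_antisymm ?_ (le_inf (boundaries_le_chains F 0) (boundaries_le_ker F 0))
  rintro x ⟨hx, hxker⟩
  obtain ⟨v, hv⟩ := hX.1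
  obtain ⟨y, hy, b, hb, rfl⟩ := Submodule.mem_sup.1 (chains_zero_le_span_sup_boundaries F hX hv hx)
  obtain ⟨a, rfl⟩ := Submodule.mem_span_singleton.1 hy
  have ha : (Finsupp.single ∅ a : Finset V →₀ F) = 0 := by
    rw [SetLike.mem_coe, LinearMap.mem_ker, map_add, LinearMap.mem_ker.1 (boundaries_le_ker F 0 hb),
      add_zero, Finsupp.smul_single_one, boundaryMap_single_singleton] at hxker
    exact hxker
  rwa [Finsupp.single_eq_zero.1 ha, zero_smul, zero_add]

theorem betti_zero_eq_one (hX : X.faces.Finite) (hconn : X.Connected) : X.betti F 0 = 1 := by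
  obtain ⟨v, hv⟩ := hconn.1
  have := finiteDimensional_chains F hX 0
  have hrank := finrank_map_add_finrank_inf_ker (boundaryMap V F) (X.chains F 0)
  rw [map_chains_zero F hv, finrank_span_singleton (Finsupp.single_ne_zero.2 one_ne_zero),
    chains_zero_inf_ker F hconn, finrank_chains F hX, ← betti_zero_add F hX] at hrank
  exact (Nat.add_right_cancel hrank).symm

end Homology

section LowerBound

variable {V : Type*} [LinearOrder V] (F : Type*) [Field F] (X : PreAbstractSimplicialComplex V)
  {k d l : ℕ}

/-- The gap in the lower bound for `g_{l+1}`, divided by `C(d + 2, l + 1)`. -/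
noncomputable def normalizedGap (d l : ℕ) : ℚ :=
  normalizedG X d (l + 1) - ∑ i ∈ Icc 1 l, (-1) ^ (l - i) * (X.betti F i : ℚ)

theorem gNumber_eq_add_normalizedGap (hl : l ≤ d + 1) :
    (X.gNumber d (l + 1) : ℚ) = (d + 2).choose (l + 1) *
      (∑ i ∈ Icc 1 l, (-1) ^ (l - i) * (X.betti F i : ℚ) + normalizedGap F X d l) := by
  rw [gNumber_eq_choose_mul X (by omega), normalizedGap, add_sub_cancel]

variable {X}

theorem normalizedGap_eq (hX : X.IsW k d) :
    normalizedGap F X d l =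
      normalizedG X d (l + 1) + (-1) ^ l - altSum l fun i => (X.betti F i : ℚ) := by
  rw [normalizedGap, altSum_eq_sum_Icc, betti_zero_eq_one F hX.finite hX.connected, Nat.cast_one,
    mul_one]
  ring

theorem normalizedGap_nonneg (hX : X.IsW k d) (hl : l + k + 1 ≤ d) : 0 ≤ normalizedGap F X d l := by
  rw [normalizedGap_eq F hX, sub_nonneg, altSum_betti F hX.finite]
  exact altSum_faceCount_sub_le hX hl fun C hC hCX =>
    hC.length_le_finrank_boundaries F hX.finite hCX

theorem normalizedGap_add_succ (hX : X.IsW k d) (hkl : k ≤ l) (hl : l + k + 2 ≤ d) :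
    normalizedGap F X d l + normalizedGap F X d (l + 1) = -X.betti F (l + 1) := by
  have hG := normalizedG_succ_add_eq_zero hX (j := l + 1) (by omega) (by omega)
  rw [normalizedGap_eq F hX, normalizedGap_eq F hX, altSum_succ, pow_succ]
  linear_combination hG

theorem betti_succ_eq_zero (hX : X.IsW k d) (hkl : k ≤ l) (hl : l + k + 2 ≤ d) :
    X.betti F (l + 1) = 0 := by
  have hadd := normalizedGap_add_succ F hX hkl hl
  have hgap := normalizedGap_nonneg F hX (l := l) (by omega)
  have hgap_succ := normalizedGap_nonneg F hX (l := l + 1) (by omega)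
  exact_mod_cast le_antisymm (by linarith : (X.betti F (l + 1) : ℚ) ≤ 0) (Nat.cast_nonneg _)

theorem normalizedGap_eq_zero (hX : X.IsW k d) (hd : 2 * k + 2 ≤ d) (hkl : k ≤ l)
    (hl : l + k + 1 ≤ d) : normalizedGap F X d l = 0 := by
  have hconsecutive : ∀ m, k ≤ m → m + k + 2 ≤ d →
      normalizedGap F X d m = 0 ∧ normalizedGap F X d (m + 1) = 0 := fun m hkm hm => by
    have hadd := normalizedGap_add_succ F hX hkm hm
    rw [betti_succ_eq_zero F hX hkm hm, Nat.cast_zero, neg_zero] at hadd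
    exact (add_eq_zero_iff_of_nonneg (normalizedGap_nonneg F hX (by omega))
      (normalizedGap_nonneg F hX (by omega))).1 hadd
  obtain hlt | hge := lt_or_ge (l + k + 1) d
  · exact (hconsecutive l hkl hlt).1
  · obtain ⟨m, rfl⟩ := Nat.exists_eq_add_of_lt (show k < l by omega)
    exact (hconsecutive (k + m) (by omega) (by omega)).2

end LowerBound

end LocallyStellated

theorem proposition4p21_general {V : Type*} [LinearOrder V] (F : Type*) [Field F] (k d : ℕ)
    (M : PreAbstractSimplicialComplex V) (hM : M.IsW k d) :
    (∀ l : ℕ, l + k + 1 ≤ d →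
      M.gNumber d (l + 1) ≥
        ((d + 2).choose (l + 1) : ℤ) * ∑ i ∈ Finset.Icc 1 l, (-1) ^ (l - i) * (M.betti F i : ℤ)) ∧
    (2 * k + 2 ≤ d → ∀ l : ℕ, k ≤ l → l + k + 1 ≤ d →
      M.gNumber d (l + 1) =
        ((d + 2).choose (l + 1) : ℤ) * ∑ i ∈ Finset.Icc 1 l, (-1) ^ (l - i) * (M.betti F i : ℤ)) ∧
    (∀ i : ℕ, k + 1 ≤ i → i + k + 1 ≤ d → M.betti F i = 0) := by
  refine ⟨fun l hl => ?_, fun hd l hkl hl => ?_, fun i hki hi => ?_⟩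
  · have hgap := LocallyStellated.normalizedGap_nonneg F hM hl
    rw [ge_iff_le, ← Int.cast_le (R := ℚ),
      LocallyStellated.gNumber_eq_add_normalizedGap F M (by omega)]
    push_cast
    gcongr
    exact le_add_of_nonneg_right hgap
  · rw [← Int.cast_inj (α := ℚ), LocallyStellated.gNumber_eq_add_normalizedGap F M (by omega),
      LocallyStellated.normalizedGap_eq_zero F hM hd hkl hl, add_zero]
    push_cast
    rfl
  · obtain ⟨m, rfl⟩ := Nat.exists_eq_add_of_lt hki
    exact LocallyStellated.betti_succ_eq_zero F hM (by omega) (by omega)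

theorem proposition4p21 {V : Type*} [LinearOrder V] (F : Type*) [Field F] (k d : ℕ)
    (M : PreAbstractSimplicialComplex V) (hM : M.IsW k d) (hN : M.Neighbourly 2) :
    (d = 2 * k → ∀ l : ℕ, 1 ≤ l → l + 1 ≤ k →
      M.gNumber d (l + 1) ≥
        ((d + 2).choose (l + 1) : ℤ) * ∑ i ∈ Finset.Icc 1 l, (-1) ^ (l - i) * (M.betti F i : ℤ)) ∧
    (2 * k + 1 ≤ d → ∀ l : ℕ, 1 ≤ l → l ≤ k →
      M.gNumber d (l + 1) ≥
        ((d + 2).choose (l + 1) : ℤ) * ∑ i ∈ Finset.Icc 1 l, (-1) ^ (l - i) * (M.betti F i : ℤ)) ∧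
    (2 * k + 2 ≤ d → ∀ l : ℕ, k ≤ l → l + k + 1 ≤ d →
      M.gNumber d (l + 1) =
        ((d + 2).choose (l + 1) : ℤ) * ∑ i ∈ Finset.Icc 1 l, (-1) ^ (l - i) * (M.betti F i : ℤ)) ∧
    (2 * k + 2 ≤ d → ∀ i : ℕ, k + 1 ≤ i → i + k + 1 ≤ d → M.betti F i = 0) := by
  obtain ⟨hge, heq, hbetti⟩ := proposition4p21_general F k d M hM
  exact ⟨fun _ l _ _ => hge l (by omega), fun _ l _ _ => hge l (by omega), heq, fun _ => hbetti⟩
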